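/- **Definitions.** Let $\mathbb{B}=\{0,1\}$ and consider functions $f:\mathbb{B}^I\to\mathbb{R}$. A *decision tree* branches on single components $x_i$ and has real leaves; its size is its number of nodes. An *algebraic decision diagram* (ADD) is a rooted diagram with real terminals and shared decision nodes, each testing one component $x_i$, in which along every path the components are inspected (possibly skipping some) in one common, arbitrary order; its size is its number of nodes. A *rule system* is a finite family of rules $\bigwedge_{(i,v)\in A_r}(x_i=v)\Rightarrow f(x)=c_r$ such that every $x\in\mathbb{B}^I$ satisfies exactly one antecedent; its size is $\sum_r(1+|A_r|)$. An *MILP-based feature representation* of $f$ consists of a feature map $\phi:\mathbb{B}^I\to\mathbb{B}^F$ and a function $\rho:\mathbb{B}^F\to\mathbb{R}$ depending only on the features in a set $J\subseteq\{1,\dots,F\}$ such that $f=\rho\circ\phi$, together with a system of $F_c$ linear inequalities with integer data defining a polyhedron $\mathcal{F}$ such that for all $x\in\mathbb{B}^I$, $\varphi\in\mathbb{B}^F$ $$\phi(x)=\varphi\iff(\varphi,\zeta;x)\in\mathcal{F}\text{ for some }\zeta\in\mathbb{R}^{F_l}\times\mathbb{B}^{F_b}.$$ Its size is $F+F_l+F_b+F_c$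 plus the total bit length of the coefficients and right-hand sides of the system ($0$ having bit length $0$) plus the number $2^{|J|}$ of entries of the table of values of $\rho$. **Theorem.** (i) There is a polynomial $p$ such that for every $I$ and every $f:\mathbb{B}^I\to\mathbb{R}$, any decision tree, ADD or rule system of size $s$ that represents $f$ has an equivalent MILP-based feature representation of size at most $p(s)$. (ii) There are a constant $\delta>0$ and MILP-based feature representations of arbitrarily large size $s$ such that every equivalent decision tree, every equivalent ADD and every equivalent rule system has size at least $2^{\delta s}$. In particular: - *Parity.* There is a constant $C$ such that for all $I\ge1$ the function with value $1$ if $\sum_i x_i$ is even and $0$ otherwise on $\mathbb{B}^I$ has an MILP-based feature representation of size at most $CI$, whereas every decision tree and every rule system that represents it has size at least $2^I$. - *Binary multiplication.* There are constants $C$ and $\delta>0$ such that for all $I\ge1$ each of the $2I$ bits of the product of two $I$-bit numbers, as a function on $\mathbb{B}^{2I}$, has an MILP-based feature representation of size at most $CI$, whereas every ADD that represents the bit of weight $2^{I-1}$ has size at least $2^{\delta I}$. -/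

import Mathlib

noncomputable section

namespace CSI

/-- The binary vectors `𝔹^I`. -/
abbrev BVec (I : ℕ) : Type := Fin I → Bool

/-! ### Decision trees -/

/-- Decision trees over the variables `x_i`, `i : Fin I`, with real leaves.  The first subtree
of `branch i` is followed if `x_i = 1` and the second one if `x_i = 0`. -/
inductive DecisionTree (I : ℕ) : Type
  | leaf (c : ℝ) : DecisionTree I
  | branch (i : Fin I) (hi lo : DecisionTree I) : DecisionTree I

namespace DecisionTree

variable {I : ℕ}

def eval : DecisionTree I → BVec I → ℝ
  | leaf c, _ => c
  | branch i hi lo, x => if x i = true then hi.eval x else lo.eval x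

/-- The number of nodes (inner nodes and leaves). -/
def size : DecisionTree I → ℕ
  | leaf _ => 1
  | branch _ hi lo => hi.size + lo.size + 1

def Represents (t : DecisionTree I) (f : BVec I → ℝ) : Prop :=
  ∀ x, t.eval x = f x

end DecisionTree

/-! ### Algebraic decision diagrams -/

/-- A node of a decision diagram with `m` nodes: a terminal carrying a real constant, or a
decision node testing `x_i`, with successor `hi` if `x_i = 1` and `lo` if `x_i = 0`. -/
inductive ADDNode (I m : ℕ) : Type
  | terminal (c : ℝ) : ADDNode I m
  | decision (i : Fin I) (hi lo : Fin m) : ADDNode I m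

/-- The position in the variable order `pos` of the variable that a node tests; terminals come
after all the variables. -/
def ADDNode.level {I m : ℕ} (pos : Equiv.Perm (Fin I)) : ADDNode I m → ℕ
  | .terminal _ => I
  | .decision i _ _ => (pos i : ℕ)

/-- An algebraic decision diagram: a finite diagram with a root, whose nodes may be shared, in
which the variables are inspected along every path in one common order `pos` (which belongs to
the diagram and is arbitrary).  Variables may be skipped along a path. -/
structure ADD (I : ℕ) where
  numNodes : ℕ
  node : Fin numNodes → ADDNode I numNodes
  root : Fin numNodes
  pos : Equiv.Perm (Fin I)
  ordered : ∀ u i hi lo, node u = .decision i hi lo →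
    (pos i : ℕ) < (node hi).level pos ∧ (pos i : ℕ) < (node lo).level pos

namespace ADD

variable {I : ℕ}

/-- The value of the sub-diagram rooted at the node `u`. -/
def evalAt (D : ADD I) (x : BVec I) (u : Fin D.numNodes) : ℝ :=
  match h : D.node u with
  | .terminal c => c
  | .decision i hi lo => if x i = true then D.evalAt x hi else D.evalAt x lo
termination_by I - (D.node u).level D.pos
decreasing_by
  all_goals
    have h1 := D.ordered u i hi lo h
    have h2 := (D.pos i).isLt
    rw [h]
    simp only [ADDNode.level] at h1 ⊢
    omega

def eval (D : ADD I) (x : BVec I) : ℝ := D.evalAt x D.root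

/-- The number of nodes of the diagram, each shared node being counted once. -/
def size (D : ADD I) : ℕ := D.numNodes

def Represents (D : ADD I) (f : BVec I → ℝ) : Prop :=
  ∀ x, D.eval x = f x

end ADD

/-! ### Rule systems -/

/-- A rule system: rules `⋀_{(i, v) ∈ A_r} (x_i = v) ⇒ c_r` whose antecedents are mutually
exclusive and jointly exhaustive on `𝔹^I`. -/
structure RuleSystem (I : ℕ) where
  numRules : ℕ
  antecedents : Fin numRules → Finset (Fin I × Bool)
  value : Fin numRules → ℝ
  existsUnique_rule : ∀ x : BVec I, ∃! r, ∀ p ∈ antecedents r, x p.1 = p.2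

namespace RuleSystem

variable {I : ℕ}

/-- The number of rules plus the total number of literals in their antecedents. -/
def size (S : RuleSystem I) : ℕ := ∑ r, (1 + (S.antecedents r).card)

def Represents (S : RuleSystem I) (f : BVec I → ℝ) : Prop :=
  ∀ r x, (∀ p ∈ S.antecedents r, x p.1 = p.2) → f x = S.value r

end RuleSystem

/-! ### MILP-based feature representations -/

/-- A system of `Fc` linear inequalities with integer data in `F` feature variables, `Fl`
continuous and `Fb` binary auxiliary variables, and `I` input variables. -/
structure MILPSystem (I F : ℕ) where
  Fl : ℕ
  Fb : ℕ
  Fc : ℕ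
  coefFeature : Fin Fc → Fin F → ℤ
  coefCont : Fin Fc → Fin Fl → ℤ
  coefBin : Fin Fc → Fin Fb → ℤ
  coefInput : Fin Fc → Fin I → ℤ
  rhs : Fin Fc → ℤ

namespace MILPSystem

variable {I F : ℕ}

/-- `(φ, ζ; x)`, with `ζ = (ζl, ζb)`, lies in the polyhedron of the system. -/
def Mem (P : MILPSystem I F) (φ : BVec F) (ζl : Fin P.Fl → ℝ) (ζb : BVec P.Fb) (x : BVec I) :
    Prop :=
  ∀ k, ∑ j, (P.coefFeature k j : ℝ) * ((φ j).toNat : ℝ)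
      + ∑ j, (P.coefCont k j : ℝ) * ζl j
      + ∑ j, (P.coefBin k j : ℝ) * ((ζb j).toNat : ℝ)
      + ∑ j, (P.coefInput k j : ℝ) * ((x j).toNat : ℝ) ≤ (P.rhs k : ℝ)

/-- The bit length of an integer; it is `0` for the integer `0`, so that only nonzero
coefficients are charged. -/
def bits (z : ℤ) : ℕ := Nat.size z.natAbs

/-- The number of variables (features and auxiliary variables) and constraints, plus the bit
lengths of all the coefficients and right-hand sides. -/
def size (P : MILPSystem I F) : ℕ :=
  F + P.Fl + P.Fb + P.Fc
    + ∑ k, (∑ j, bits (P.coefFeature k j) + ∑ j, bits (P.coefCont k j)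
        + ∑ j, bits (P.coefBin k j) + ∑ j, bits (P.coefInput k j) + bits (P.rhs k))

end MILPSystem

/-- An MILP-based feature representation `x ↦ ρ (φ x)`: a feature map `φ : 𝔹^I → 𝔹^F` together
with a mixed-integer linear representation of it, and a function `ρ : 𝔹^F → ℝ` that depends on
the features in `scope` only. -/
structure MILPFeatureRep (I : ℕ) where
  F : ℕ
  φ : BVec I → BVec F
  milp : MILPSystem I F
  φ_eq_iff : ∀ x φ', φ x = φ' ↔ ∃ ζl ζb, milp.Mem φ' ζl ζb x
  ρ : BVec F → ℝ
  scope : Finset (Fin F)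
  ρ_scope : ∀ φ' φ'' : BVec F, (∀ j ∈ scope, φ' j = φ'' j) → ρ φ' = ρ φ''

namespace MILPFeatureRep

variable {I : ℕ}

/-- The size of the mixed-integer linear system plus the number `2 ^ |scope|` of entries of the
table of values of `ρ`; so the scope is at most logarithmic in the size. -/
def size (R : MILPFeatureRep I) : ℕ := R.milp.size + 2 ^ R.scope.card

def Represents (R : MILPFeatureRep I) (f : BVec I → ℝ) : Prop :=
  ∀ x, R.ρ (R.φ x) = f x

end MILPFeatureRep

/-! ### Parity and binary multiplication -/

/-- `1` if the number of ones in `x` is even, and `0` otherwise. -/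
def parity (I : ℕ) (x : BVec I) : ℝ :=
  if Even (∑ i, (x i).toNat) then 1 else 0

/-- The natural number with the binary digits `a`, the least significant one first. -/
def binVal {I : ℕ} (a : BVec I) : ℕ := ∑ i : Fin I, (a i).toNat * 2 ^ (i : ℕ)

/-- The bit of weight `2 ^ k` of the product of the `I`-bit numbers `a` and `b`, the input being
the vector `(a, b)` of length `I + I`. -/
def mulBit (I k : ℕ) (x : BVec (I + I)) : ℝ :=
  if (binVal (fun i : Fin I => x (Fin.castAdd I i))
      * binVal (fun i : Fin I => x (Fin.natAdd I i))).testBit k = true then 1 else 0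

end CSI

end

/-!
A representation of `f` by rules becomes an MILP-based one by letting the features spell a binary
code of the rule that applies: the codes have logarithmic length, so the table of `ρ` has linear
size, and a rule fixes each bit of its code by a single inequality. The root-to-leaf paths of a
decision tree are such rules. In a decision diagram the code, now of the terminal reached, is
instead passed up from the successors of every node, since a diagram can have exponentially many
paths.

The parity of a vector is computed through the parities of its prefixes. Products of `I`-bit
numbers are computed with bounded coefficients by scaling: a register that repeatedly takes up a
digit and is halved ends with the number read divided by `2 ^ I`. This lies in `[0, 1]`, which makes
its products with bits linear; a second register adds these up, and a third one matches the result
with the bits of the product.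

If `f` changes under every flip of a single component, then the antecedents of a rule mention all
components, whence `2 ^ I` rules and leaves. For diagrams, cut the variable order where half of a
block of digits of the first factor has been read. Then for some distance `d` there are linearly
many pairs of digits at distance `d` that the cut separates. Multiplying by a number with two ones
at distance `d` adds the two digits of every pair, so that the middle bit of the product is a carry
that compares the parts read before and after the cut; hence all the choices of the first part lead
to different nodes. The function from which both the middle bit and the parity can be recovered is
hard for trees, diagrams and rule systems simultaneously.
-/

noncomputable section

namespace CSI

namespace MILPSystem

theorem bits_le_iff {z : ℤ} {k : ℕ} : bits z ≤ k ↔ z.natAbs < 2 ^ k := Nat.size_le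

theorem natAbs_lt_two_pow_bits (z : ℤ) : z.natAbs < 2 ^ bits z := bits_le_iff.1 le_rfl

theorem bits_le_natAbs (z : ℤ) : bits z ≤ z.natAbs := bits_le_iff.2 Nat.lt_two_pow_self

theorem bits_add_le (a b : ℤ) : bits (a + b) ≤ bits a + bits b := by
  rw [bits_le_iff, pow_add]
  calc (a + b).natAbs
      < (a.natAbs + 1) * (b.natAbs + 1) := by
        nlinarith [Int.natAbs_add_le a b, Nat.zero_le (a.natAbs * b.natAbs)]
    _ ≤ 2 ^ bits a * 2 ^ bits b :=
        Nat.mul_le_mul (natAbs_lt_two_pow_bits a) (natAbs_lt_two_pow_bits b)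

@[simp] theorem bits_zero : bits 0 = 0 := by simp [bits]

@[simp] theorem bits_one : bits 1 = 1 := by simp [bits]

@[simp] theorem bits_two : bits 2 = 2 := by decide

@[simp] theorem bits_neg (z : ℤ) : bits (-z) = bits z := by simp [bits]

end MILPSystem

open MILPSystem
open scoped Finset

/-! ### Systems of sparse linear constraints -/

/-- A linear inequality `∑ a v ≤ rhs` over the variables `v : V`, given by the list of its terms
`(a, v)`.  A variable may occur in several terms, whose coefficients then add up. -/
structure Constraint (V : Type*) where
  terms : List (ℤ × V)
  rhs : ℤ

namespace Constraint

variable {V W : Type*}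

/-- The constraint is satisfied by the valuation `v`. -/
def Holds (c : Constraint V) (v : V → ℝ) : Prop :=
  (c.terms.map fun t => (t.1 : ℝ) * v t.2).sum ≤ (c.rhs : ℝ)

/-- The bit length of the data of a constraint. -/
def cost (c : Constraint V) : ℕ := (c.terms.map fun t => bits t.1).sum + bits c.rhs

/-- The constraint obtained by substituting the variable `g v` for `v`. -/
def rename (g : V → W) (c : Constraint V) : Constraint W :=
  ⟨c.terms.map fun t => (t.1, g t.2), c.rhs⟩

theorem holds_rename {g : V → W} {c : Constraint V} {v : W → ℝ} :
    (c.rename g).Holds v ↔ c.Holds (v ∘ g) := by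
  simp [rename, Holds, Function.comp_def]

@[simp] theorem cost_rename (g : V → W) (c : Constraint V) : (c.rename g).cost = c.cost := by
  simp [rename, cost, Function.comp_def]

open Classical in
/-- The total coefficient of the variable `v` in a list of terms. -/
def coef (terms : List (ℤ × V)) (v : V) : ℤ :=
  (terms.map fun t => if v = t.2 then t.1 else 0).sum

theorem sum_coef_mul [Fintype V] (terms : List (ℤ × V)) (val : V → ℝ) :
    ∑ v, (coef terms v : ℝ) * val v = (terms.map fun t => (t.1 : ℝ) * val t.2).sum := by
  classical
  induction terms with
  | nil => simp [coef]
  | cons t terms ih =>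
    have coef_cons_mul (v : V) : (coef (t :: terms) v : ℝ) * val v
        = (if v = t.2 then (t.1 : ℝ) * val v else 0) + (coef terms v : ℝ) * val v := by
      simp only [coef, List.map_cons, List.sum_cons]
      split_ifs <;> push_cast <;> ring
    simp only [coef_cons_mul, Finset.sum_add_distrib, ih, Finset.sum_ite_eq', Finset.mem_univ,
      if_true, List.map_cons, List.sum_cons]

theorem sum_bits_coef_le [Fintype V] (terms : List (ℤ × V)) :
    ∑ v, bits (coef terms v) ≤ (terms.map fun t => bits t.1).sum := by
  classical
  induction terms with
  | nil => simp [coef]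
  | cons t terms ih =>
    have bits_coef_cons_le (v : V) : bits (coef (t :: terms) v)
        ≤ (if v = t.2 then bits t.1 else 0) + bits (coef terms v) := by
      simp only [coef, List.map_cons, List.sum_cons]
      refine (bits_add_le _ _).trans ?_
      split_ifs <;> simp
    calc ∑ v, bits (coef (t :: terms) v)
        ≤ ∑ v, ((if v = t.2 then bits t.1 else 0) + bits (coef terms v)) :=
          Finset.sum_le_sum fun v _ => bits_coef_cons_le v
      _ = bits t.1 + ∑ v, bits (coef terms v) := by simp [Finset.sum_add_distrib]
      _ ≤ ((t :: terms).map fun t => bits t.1).sum := by simpa using ih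

end Constraint

section Systems

variable {α V W : Type*}

/-- The valuation `v` solves the system `cons`. -/
def Satisfies (cons : List (Constraint V)) (v : V → ℝ) : Prop := ∀ c ∈ cons, c.Holds v

/-- The number of constraints of a system plus the bit length of their data. -/
def totalCost (cons : List (Constraint V)) : ℕ := (cons.map fun c => 1 + c.cost).sum

/-- The union of a finite family of systems. -/
def gather [Fintype α] (cons : α → List (Constraint V)) : List (Constraint V) :=
  Finset.univ.toList.flatMap cons

@[simp] theorem satisfies_nil {v : V → ℝ} : Satisfies [] v := by simp [Satisfies]

@[simp] theorem satisfies_cons {c : Constraint V} {cons : List (Constraint V)} {v : V → ℝ} :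
    Satisfies (c :: cons) v ↔ c.Holds v ∧ Satisfies cons v := by
  simp [Satisfies]

@[simp] theorem satisfies_append {cons cons' : List (Constraint V)} {v : V → ℝ} :
    Satisfies (cons ++ cons') v ↔ Satisfies cons v ∧ Satisfies cons' v :=
  List.forall_mem_append

@[simp] theorem satisfies_map_rename {g : V → W} {cons : List (Constraint V)} {v : W → ℝ} :
    Satisfies (cons.map (.rename g)) v ↔ Satisfies cons (v ∘ g) := by
  simp [Satisfies, Constraint.holds_rename]

@[simp] theorem satisfies_gather [Fintype α] {cons : α → List (Constraint V)} {v : V → ℝ} :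
    Satisfies (gather cons) v ↔ ∀ a, Satisfies (cons a) v := by
  simp [Satisfies, gather, forall_comm (α := α)]

@[simp] theorem totalCost_nil : totalCost ([] : List (Constraint V)) = 0 := rfl

@[simp] theorem totalCost_cons (c : Constraint V) (cons : List (Constraint V)) :
    totalCost (c :: cons) = 1 + c.cost + totalCost cons := by
  simp [totalCost]

@[simp] theorem totalCost_append (cons cons' : List (Constraint V)) :
    totalCost (cons ++ cons') = totalCost cons + totalCost cons' := by
  simp [totalCost]

@[simp] theorem totalCost_map_rename (g : V → W) (cons : List (Constraint V)) :
    totalCost (cons.map (.rename g)) = totalCost cons := by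
  simp [totalCost, Function.comp_def]

@[simp] theorem totalCost_gather [Fintype α] (cons : α → List (Constraint V)) :
    totalCost (gather cons) = ∑ a, totalCost (cons a) := by
  rw [totalCost, gather, List.map_flatMap, List.flatMap_def, List.sum_flatten, List.map_map,
    Finset.sum_map_toList]
  rfl

theorem totalCost_gather_le [Fintype α] {cons : α → List (Constraint V)} {w : ℕ}
    (h : ∀ a, totalCost (cons a) ≤ w) : totalCost (gather cons) ≤ Fintype.card α * w := by
  simpa using Finset.sum_le_card_nsmul Finset.univ _ w fun a _ => h a

/-- The real `0/1` valuation given by a Boolean valuation. -/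
def boolVal (b : V → Bool) : V → ℝ := fun v => ((b v).toNat : ℝ)

end Systems

/-! ### Feature representations from constraint systems -/

/-- The variables of a system with features `Φ`, real auxiliary variables `L` and inputs `Fin I`. -/
abbrev Var (Φ L : Type*) (I : ℕ) : Type _ := Φ ⊕ L ⊕ Fin I

section FeatureSystems

variable {Φ Φ' L L' : Type*} {I : ℕ}

namespace Var

/-- The variable of a feature. -/
abbrev feature (j : Φ) : Var Φ L I := .inl j

/-- An auxiliary variable. -/
abbrev aux (l : L) : Var Φ L I := .inr (.inl l)

/-- The variable of an input component. -/
abbrev input (i : Fin I) : Var Φ L I := .inr (.inr i)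

end Var

/-- The valuation with features `φ`, auxiliary variables `ζ` and input `x`. -/
def assign (φ : Φ → Bool) (ζ : L → ℝ) (x : BVec I) : Var Φ L I → ℝ :=
  Sum.elim (boolVal φ) (Sum.elim ζ (boolVal x))

/-- The system determines the features to be `φ x`, the auxiliary variables being existentially
quantified. -/
def IsFeatureSystem (cons : List (Constraint (Var Φ L I))) (φ : BVec I → Φ → Bool) : Prop :=
  ∀ x φ', φ x = φ' ↔ ∃ ζ : L → ℝ, Satisfies cons (assign φ' ζ x)

theorem isFeatureSystem_iff_of_isEmpty [IsEmpty L] {cons : List (Constraint (Var Φ L I))}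
    {φ : BVec I → Φ → Bool} :
    IsFeatureSystem cons φ ↔ ∀ x φ', φ x = φ' ↔
      Satisfies cons (boolVal (Sum.elim φ' (Sum.elim isEmptyElim x))) := by
  have assign_eq (x : BVec I) (φ' : Φ → Bool) (ζ : L → ℝ) :
      assign φ' ζ x = boolVal (Sum.elim φ' (Sum.elim isEmptyElim x)) := by
    ext (j | l | i)
    exacts [rfl, isEmptyElim l, rfl]
  simp only [IsFeatureSystem, assign_eq, exists_const]

section Matrix

variable [Fintype Φ] [Fintype L]

/-- The matrix form of a system of sparse constraints. -/
abbrev toMILPSystem (cons : List (Constraint (Var Φ L I))) : MILPSystem I (Fintype.card Φ) where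
  Fl := Fintype.card L
  Fb := 0
  Fc := cons.length
  coefFeature k j := Constraint.coef cons[k].terms (.feature ((Fintype.equivFin Φ).symm j))
  coefCont k l := Constraint.coef cons[k].terms (.aux ((Fintype.equivFin L).symm l))
  coefBin _ _ := 0
  coefInput k i := Constraint.coef cons[k].terms (.input i)
  rhs k := cons[k].rhs

theorem mem_toMILPSystem_iff {cons : List (Constraint (Var Φ L I))} {φ : BVec (Fintype.card Φ)}
    {ζ : Fin (Fintype.card L) → ℝ} {ζb : BVec 0} {x : BVec I} :
    (toMILPSystem cons).Mem φ ζ ζb x ↔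
      Satisfies cons (assign (φ ∘ Fintype.equivFin Φ) (ζ ∘ Fintype.equivFin L) x) := by
  rw [Satisfies, List.forall_mem_iff_forall_getElem]
  refine Iff.trans (forall_congr' fun k : Fin cons.length => ?_) (Fin.forall_iff (p := fun k =>
    (cons[k]).Holds (assign (φ ∘ Fintype.equivFin Φ) (ζ ∘ Fintype.equivFin L) x)))
  simp only [Constraint.Holds, ← Constraint.sum_coef_mul, Fintype.sum_sum_type,
    ← (Fintype.equivFin Φ).symm.sum_comp, ← (Fintype.equivFin L).symm.sum_comp]
  simp [assign, boolVal, add_assoc]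

theorem size_toMILPSystem_le (cons : List (Constraint (Var Φ L I))) :
    (toMILPSystem cons).size ≤ Fintype.card Φ + Fintype.card L + totalCost cons := by
  have totalCost_eq : totalCost cons = cons.length + ∑ k : Fin cons.length, cons[k].cost := by
    simp [totalCost, List.sum_map_add, Fin.sum_univ_fun_getElem cons Constraint.cost]
  rw [totalCost_eq, ← add_assoc, MILPSystem.size]
  refine add_le_add (by simp) (Finset.sum_le_sum fun k _ => ?_)
  refine le_trans (le_of_eq ?_)
    (Nat.add_le_add_right (Constraint.sum_bits_coef_le cons[k].terms) (bits cons[k].rhs))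
  simp [Fintype.sum_sum_type, ← (Fintype.equivFin Φ).symm.sum_comp,
    ← (Fintype.equivFin L).symm.sum_comp, add_assoc]

/-- The feature representation given by a system determining `φ` and a function `ρ` of the features
in `S`. -/
def IsFeatureSystem.toMILPFeatureRep {cons : List (Constraint (Var Φ L I))}
    {φ : BVec I → Φ → Bool} (h : IsFeatureSystem cons φ) (S : Finset Φ) (ρ : (Φ → Bool) → ℝ)
    (hρ : DependsOn ρ (S : Set Φ)) : MILPFeatureRep I where
  F := Fintype.card Φ
  φ x := φ x ∘ (Fintype.equivFin Φ).symm
  milp := toMILPSystem cons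
  φ_eq_iff x φ' := by
    rw [Equiv.comp_symm_eq, h x]
    constructor
    · rintro ⟨ζ, hζ⟩
      refine ⟨ζ ∘ (Fintype.equivFin L).symm, Fin.elim0, mem_toMILPSystem_iff.2 ?_⟩
      simpa [Function.comp_assoc] using hζ
    · rintro ⟨ζ, ζb, hζ⟩
      exact ⟨_, mem_toMILPSystem_iff.1 hζ⟩
  ρ φ' := ρ (φ' ∘ Fintype.equivFin Φ)
  scope := S.map (Fintype.equivFin Φ).toEmbedding
  ρ_scope φ' φ'' hs := hρ fun j hj => hs _ (by simpa using hj)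

namespace IsFeatureSystem

variable {cons : List (Constraint (Var Φ L I))} {φ : BVec I → Φ → Bool}
  (h : IsFeatureSystem cons φ) {S : Finset Φ} {ρ : (Φ → Bool) → ℝ} (hρ : DependsOn ρ (S : Set Φ))

theorem represents_toMILPFeatureRep :
    (h.toMILPFeatureRep S ρ hρ).Represents fun x => ρ (φ x) := fun x => by
  simp [toMILPFeatureRep, Function.comp_assoc]

theorem card_le_size_toMILPFeatureRep : Fintype.card Φ ≤ (h.toMILPFeatureRep S ρ hρ).size := by
  simp only [MILPFeatureRep.size, MILPSystem.size, toMILPFeatureRep]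
  lia

theorem size_toMILPFeatureRep_le : (h.toMILPFeatureRep S ρ hρ).size
    ≤ Fintype.card Φ + Fintype.card L + totalCost cons + 2 ^ S.card := by
  simpa [MILPFeatureRep.size, toMILPFeatureRep] using size_toMILPSystem_le cons

end IsFeatureSystem

end Matrix

/-- Two systems over the same input, side by side. -/
def joinSystems (cons : List (Constraint (Var Φ L I))) (cons' : List (Constraint (Var Φ' L' I))) :
    List (Constraint (Var (Φ ⊕ Φ') (L ⊕ L') I)) :=
  cons.map (.rename (Sum.map .inl (Sum.map .inl id))) ++
    cons'.map (.rename (Sum.map .inr (Sum.map .inr id)))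

theorem totalCost_joinSystems (cons : List (Constraint (Var Φ L I)))
    (cons' : List (Constraint (Var Φ' L' I))) :
    totalCost (joinSystems cons cons') = totalCost cons + totalCost cons' := by
  simp [joinSystems]

theorem satisfies_joinSystems {cons : List (Constraint (Var Φ L I))}
    {cons' : List (Constraint (Var Φ' L' I))} {φ : Φ ⊕ Φ' → Bool} {ζ : L ⊕ L' → ℝ} {x : BVec I} :
    Satisfies (joinSystems cons cons') (assign φ ζ x) ↔
      Satisfies cons (assign (φ ∘ .inl) (ζ ∘ .inl) x) ∧
        Satisfies cons' (assign (φ ∘ .inr) (ζ ∘ .inr) x) := by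
  have assign_comp_inl : assign φ ζ x ∘ Sum.map .inl (Sum.map .inl id)
      = assign (φ ∘ .inl) (ζ ∘ .inl) x := by
    ext (j | l | i) <;> rfl
  have assign_comp_inr : assign φ ζ x ∘ Sum.map .inr (Sum.map .inr id)
      = assign (φ ∘ .inr) (ζ ∘ .inr) x := by
    ext (j | l | i) <;> rfl
  simp only [joinSystems, satisfies_append, satisfies_map_rename, assign_comp_inl, assign_comp_inr]

theorem IsFeatureSystem.join {cons : List (Constraint (Var Φ L I))}
    {cons' : List (Constraint (Var Φ' L' I))} {φ : BVec I → Φ → Bool} {φ' : BVec I → Φ' → Bool}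
    (h : IsFeatureSystem cons φ) (h' : IsFeatureSystem cons' φ') :
    IsFeatureSystem (joinSystems cons cons') fun x => Sum.elim (φ x) (φ' x) := by
  intro x ψ
  have elim_eq_iff : Sum.elim (φ x) (φ' x) = ψ ↔ φ x = ψ ∘ .inl ∧ φ' x = ψ ∘ .inr := by
    rw [← Sum.elim_comp_inl_inr ψ, Sum.elim_eq_iff]
    simp
  rw [elim_eq_iff, h x, h' x]
  simp only [satisfies_joinSystems]
  constructor
  · rintro ⟨⟨ζ, hζ⟩, ζ', hζ'⟩
    exact ⟨Sum.elim ζ ζ', by simpa using hζ, by simpa using hζ'⟩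
  · rintro ⟨ζ, hζ, hζ'⟩
    exact ⟨⟨_, hζ⟩, _, hζ'⟩

end FeatureSystems

/-! ### Rule systems and decision trees -/

theorem exists_injective_code (α : Type*) [Fintype α] [Nonempty α] {s : ℕ}
    (hs : Fintype.card α ≤ s) :
    ∃ B ≤ s, 2 ^ B ≤ 2 * s ∧ ∃ code : α → Fin B → Bool, Function.Injective code := by
  have s_ne_zero : s ≠ 0 := (Fintype.card_pos.trans_le hs).ne'
  have card_le : Fintype.card α ≤ Fintype.card (Fin (Nat.log 2 s + 1) → Bool) := by
    simpa using hs.trans (Nat.lt_pow_succ_log_self one_lt_two s).le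
  obtain ⟨code⟩ := Function.Embedding.nonempty_of_card_le card_le
  refine ⟨_, Nat.log_lt_self 2 s_ne_zero, ?_, code, code.injective⟩
  rw [pow_succ, mul_comm]
  exact Nat.mul_le_mul_left 2 (Nat.pow_log_le_self 2 s_ne_zero)

section RuleConstraint

variable {I : ℕ} {V : Type*} (w : V) (input : Fin I → V) (A : Finset (Fin I × Bool)) (β : Bool)

/-- The constraint `[w ≠ β] ≤ #(violated literals of A)` for a binary variable `w`. -/
def ruleConstraint : Constraint V where
  terms := (if β then -1 else 1, w) :: A.toList.map fun p => (if p.2 then 1 else -1, input p.1)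
  rhs := #{p ∈ A | p.2} - if β then 1 else 0

variable {w input A β} in
theorem ruleConstraint_holds_iff {b : V → Bool} :
    (ruleConstraint w input A β).Holds (boolVal b) ↔
      ((∀ p ∈ A, b (input p.1) = p.2) → b w = β) := by
  set violated := #{p ∈ A | b (input p.1) ≠ p.2} with violated_def
  have sum_literals : (A.toList.map fun p =>
      ((if p.2 then 1 else -1 : ℤ) : ℝ) * boolVal b (input p.1)).sum
        = #{p ∈ A | p.2} - violated := by
    rw [Finset.sum_map_toList, violated_def, Finset.card_filter, Finset.card_filter]
    push_cast
    rw [← Finset.sum_sub_distrib]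
    refine Finset.sum_congr rfl fun p _ => ?_
    cases hp : p.2 <;> cases hb : b (input p.1) <;> simp [boolVal, hb]
  have violated_eq_zero : violated = 0 ↔ ∀ p ∈ A, b (input p.1) = p.2 := by
    simp [violated_def, Finset.filter_eq_empty_iff]
  simp only [ruleConstraint, Constraint.Holds, List.map_cons, List.sum_cons, List.map_map,
    Function.comp_def, sum_literals, ← violated_eq_zero]
  rcases Nat.eq_zero_or_pos violated with h | h
  · cases hb : b w <;> cases β <;> simp [boolVal, hb, h]
  · have : (1 : ℝ) ≤ violated := by exact_mod_cast h
    cases hb : b w <;> cases β <;> simp [boolVal, hb, h.ne'] <;> linarith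

theorem cost_ruleConstraint_le : (ruleConstraint w input A β).cost ≤ 2 * #A + 2 := by
  have bits_literals : (A.toList.map fun p => bits (if p.2 then 1 else -1)).sum = #A := by
    rw [Finset.sum_map_toList, Finset.card_eq_sum_ones]
    exact Finset.sum_congr rfl fun p _ => by split_ifs <;> simp
  have bits_head : bits (if β then -1 else 1) = 1 := by split_ifs <;> simp
  have bits_rhs : bits (#{p ∈ A | p.2} - if β then 1 else 0) ≤ #A + 1 := by
    refine (bits_le_natAbs _).trans ?_
    have := Finset.card_filter_le A fun p => p.2
    split_ifs <;> lia
  simp only [ruleConstraint, Constraint.cost, List.map_cons, List.sum_cons, List.map_map,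
    Function.comp_def, bits_literals, bits_head]
  lia

end RuleConstraint

namespace RuleSystem

variable {I : ℕ} (S : RuleSystem I)

/-- The rule that applies to `x`. -/
def rule (x : BVec I) : Fin S.numRules := (S.existsUnique_rule x).choose

theorem rule_spec (x : BVec I) : ∀ p ∈ S.antecedents (S.rule x), x p.1 = p.2 :=
  (S.existsUnique_rule x).choose_spec.1

variable {S} in
theorem rule_eq_iff {x : BVec I} {r : Fin S.numRules} :
    S.rule x = r ↔ ∀ p ∈ S.antecedents r, x p.1 = p.2 :=
  ⟨fun h => h ▸ S.rule_spec x, fun h => (S.existsUnique_rule x).unique (S.rule_spec x) h⟩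

theorem numRules_le_size : S.numRules ≤ S.size := by
  simp [size, Finset.sum_add_distrib]

theorem card_antecedents_le_size (r : Fin S.numRules) : #(S.antecedents r) ≤ S.size := by
  have := Finset.single_le_sum (f := fun r => 1 + #(S.antecedents r))
    (fun _ _ => Nat.zero_le _) (Finset.mem_univ r)
  simp only [size]
  lia

/-- The system whose features are the bits of the code of the rule that applies. -/
def codeSystem {B : ℕ} (code : Fin S.numRules → Fin B → Bool) :
    List (Constraint (Var (Fin B) Empty I)) :=
  gather fun q : Fin S.numRules × Fin B =>
    [ruleConstraint (.feature q.2) Var.input (S.antecedents q.1) (code q.1 q.2)]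

theorem isFeatureSystem_codeSystem {B : ℕ} (code : Fin S.numRules → Fin B → Bool) :
    IsFeatureSystem (S.codeSystem code) fun x => code (S.rule x) := by
  refine isFeatureSystem_iff_of_isEmpty.2 fun x φ' => ?_
  simp only [codeSystem, satisfies_gather, satisfies_cons, satisfies_nil, and_true,
    ruleConstraint_holds_iff, Prod.forall, Sum.elim_inl, Sum.elim_inr]
  constructor
  · rintro rfl r b hr
    rw [rule_eq_iff.2 fun p hp => hr p.1 p.2 hp]
  · exact fun h => funext fun b => (h _ b fun i v hp => S.rule_spec x (i, v) hp).symm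

theorem totalCost_codeSystem_le {B s : ℕ} (code : Fin S.numRules → Fin B → Bool)
    (hS : ∀ r, #(S.antecedents r) ≤ s) :
    totalCost (S.codeSystem code) ≤ S.numRules * B * (2 * s + 3) := by
  refine (totalCost_gather_le (w := 2 * s + 3) fun q => ?_).trans (by simp)
  have cost_le := cost_ruleConstraint_le (.feature q.2 : Var (Fin B) Empty I) Var.input
    (S.antecedents q.1) (code q.1 q.2)
  have := hS q.1
  simp only [totalCost_cons, totalCost_nil]
  lia

variable {S} in
theorem Represents.exists_featureRep {f : BVec I → ℝ} (hf : S.Represents f) {s : ℕ}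
    (hs : S.numRules ≤ s) (hS : ∀ r, #(S.antecedents r) ≤ s) :
    ∃ R : MILPFeatureRep I, R.Represents f ∧ R.size ≤ 8 * s ^ 3 := by
  have : Nonempty (Fin S.numRules) := ⟨S.rule fun _ => false⟩
  obtain ⟨B, hB, hB', code, code_injective⟩ :=
    exists_injective_code (Fin S.numRules) (by simpa using hs)
  have hsys := S.isFeatureSystem_codeSystem code
  have hρ : DependsOn (Function.extend code S.value 0) (Finset.univ : Finset (Fin B)) := by
    simp [dependsOn_univ]
  refine ⟨hsys.toMILPFeatureRep .univ (Function.extend code S.value 0) hρ, fun x => ?_,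
    (hsys.size_toMILPFeatureRep_le hρ).trans ?_⟩
  · rw [hf _ _ (S.rule_spec x)]
    exact (hsys.represents_toMILPFeatureRep hρ x).trans (code_injective.extend_apply _ _ _)
  · have hcost := (S.totalCost_codeSystem_le code hS).trans
      (Nat.mul_le_mul_right _ (Nat.mul_le_mul hs hB))
    have s_pos : 0 < s := Fin.pos_iff_nonempty.2 this |>.trans_le hs
    simp only [Fintype.card_fin, Fintype.card_empty, Finset.card_univ]
    have : s ≤ s * s := Nat.le_mul_of_pos_left s s_pos
    have : s * s ≤ s * s * s := Nat.le_mul_of_pos_right _ s_pos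
    nlinarith

/-- The rule system with a single rule, whose antecedent is empty. -/
def const (I : ℕ) (c : ℝ) : RuleSystem I where
  numRules := 1
  antecedents _ := ∅
  value _ := c
  existsUnique_rule _ := ⟨0, by simp, fun r _ => Subsingleton.elim r 0⟩

/-- The rule system whose rules are those of `S₁` with the further literal `x i = 1` and those of
`S₂` with the further literal `x i = 0`. -/
def branch (i : Fin I) (S₁ S₂ : RuleSystem I) : RuleSystem I where
  numRules := S₁.numRules + S₂.numRules
  antecedents := Fin.append (fun r => insert (i, true) (S₁.antecedents r))
    fun r => insert (i, false) (S₂.antecedents r)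
  value := Fin.append S₁.value S₂.value
  existsUnique_rule x := by
    cases hx : x i
    · refine ⟨Fin.natAdd _ (S₂.rule x), by simpa [hx] using S₂.rule_spec x, fun r hr => ?_⟩
      induction r using Fin.addCases with
      | left r => simp [hx] at hr
      | right r => rw [rule_eq_iff.2 (by simpa [hx] using hr)]
    · refine ⟨Fin.castAdd _ (S₁.rule x), by simpa [hx] using S₁.rule_spec x, fun r hr => ?_⟩
      induction r using Fin.addCases with
      | left r => rw [rule_eq_iff.2 (by simpa [hx] using hr)]
      | right r => simp [hx] at hr

theorem forall_branch {i : Fin I} {S₁ S₂ : RuleSystem I}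
    {P : Finset (Fin I × Bool) → ℝ → Prop} :
    (∀ r, P ((branch i S₁ S₂).antecedents r) ((branch i S₁ S₂).value r)) ↔
      (∀ r, P (insert (i, true) (S₁.antecedents r)) (S₁.value r)) ∧
        ∀ r, P (insert (i, false) (S₂.antecedents r)) (S₂.value r) := by
  refine ⟨fun h => ⟨fun r => ?_, fun r => ?_⟩, fun h => Fin.addCases (fun r => ?_) fun r => ?_⟩
  · simpa [branch] using h (Fin.castAdd _ r)
  · simpa [branch] using h (Fin.natAdd _ r)
  · simpa [branch] using h.1 r
  · simpa [branch] using h.2 r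

end RuleSystem

namespace DecisionTree

variable {I : ℕ}

/-- The rule system whose rules are the root-to-leaf paths of a decision tree. -/
def toRuleSystem : DecisionTree I → RuleSystem I
  | leaf c => .const I c
  | branch i hi lo => .branch i hi.toRuleSystem lo.toRuleSystem

theorem numRules_toRuleSystem_le (T : DecisionTree I) : T.toRuleSystem.numRules ≤ T.size := by
  induction T with
  | leaf c => exact le_rfl
  | branch i hi lo ih_hi ih_lo =>
    simp only [toRuleSystem, RuleSystem.branch, size]
    lia

theorem card_antecedents_toRuleSystem_le (T : DecisionTree I) :
    ∀ r, #(T.toRuleSystem.antecedents r) ≤ T.size := by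
  induction T with
  | leaf c => exact fun _ => Nat.zero_le 1
  | branch i hi lo ih_hi ih_lo =>
    refine (RuleSystem.forall_branch (P := fun A _ => #A ≤ hi.size + lo.size + 1)).2
      ⟨fun r => (Finset.card_insert_le _ _).trans ?_,
        fun r => (Finset.card_insert_le _ _).trans ?_⟩
    · linarith [ih_hi r]
    · linarith [ih_lo r]

theorem represents_toRuleSystem (T : DecisionTree I) : T.toRuleSystem.Represents T.eval := by
  induction T with
  | leaf c => exact fun _ _ _ => rfl
  | branch i hi lo ih_hi ih_lo =>
    refine (RuleSystem.forall_branch (P := fun A c => ∀ x : BVec I, (∀ p ∈ A, x p.1 = p.2) →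
      (branch i hi lo).eval x = c)).2 ⟨fun r x hx => ?_, fun r x hx => ?_⟩ <;>
    rw [Finset.forall_mem_insert] at hx
    · simpa [eval, hx.1] using ih_hi r x hx.2
    · simpa [eval, hx.1] using ih_lo r x hx.2

theorem Represents.exists_featureRep {T : DecisionTree I} {f : BVec I → ℝ} (hf : T.Represents f) :
    ∃ R : MILPFeatureRep I, R.Represents f ∧ R.size ≤ 8 * T.size ^ 3 := by
  obtain rfl : T.eval = f := funext hf
  exact T.represents_toRuleSystem.exists_featureRep T.numRules_toRuleSystem_le
    T.card_antecedents_toRuleSystem_le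

end DecisionTree

/-! ### Algebraic decision diagrams -/

namespace ADD

variable {I : ℕ} (D : ADD I)

theorem node_induction {motive : Fin D.numNodes → Prop}
    (terminal : ∀ u c, D.node u = .terminal c → motive u)
    (decision : ∀ u i hi lo, D.node u = .decision i hi lo → motive hi → motive lo → motive u)
    (u : Fin D.numNodes) : motive u := by
  induction hk : I - (D.node u).level D.pos using Nat.strong_induction_on generalizing u with
  | _ k ih =>
    cases h : D.node u with
    | terminal c => exact terminal u c h
    | decision i hi lo =>
      have level_lt := D.ordered u i hi lo h
      have pos_lt := (D.pos i).isLt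
      rw [h, ADDNode.level] at hk
      exact decision u i hi lo h (ih _ (by lia) hi rfl) (ih _ (by lia) lo rfl)

/-- The first node of level at least `ℓ` on the path that `x` selects from the node `u`. -/
def reach (ℓ : ℕ) (x : BVec I) (u : Fin D.numNodes) : Fin D.numNodes :=
  match _h : D.node u with
  | .terminal _ => u
  | .decision i hi lo =>
    if (D.pos i : ℕ) < ℓ then if x i = true then reach ℓ x hi else reach ℓ x lo else u
termination_by I - (D.node u).level D.pos
decreasing_by
  all_goals
    have level_lt := D.ordered u i hi lo _h
    have := (D.pos i).isLt
    rw [_h]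
    simp only [ADDNode.level] at level_lt ⊢
    lia

theorem evalAt_terminal {u : Fin D.numNodes} {c : ℝ} (h : D.node u = .terminal c) (x : BVec I) :
    D.evalAt x u = c := by
  rw [evalAt]
  split <;> simp_all

theorem evalAt_decision {u : Fin D.numNodes} {i : Fin I} {hi lo : Fin D.numNodes}
    (h : D.node u = .decision i hi lo) (x : BVec I) :
    D.evalAt x u = if x i = true then D.evalAt x hi else D.evalAt x lo := by
  rw [evalAt]
  split <;> simp_all

theorem reach_terminal {u : Fin D.numNodes} {c : ℝ} (h : D.node u = .terminal c) (ℓ : ℕ)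
    (x : BVec I) : D.reach ℓ x u = u := by
  rw [reach]
  split <;> simp_all

theorem reach_decision {u : Fin D.numNodes} {i : Fin I} {hi lo : Fin D.numNodes}
    (h : D.node u = .decision i hi lo) (ℓ : ℕ) (x : BVec I) :
    D.reach ℓ x u =
      if (D.pos i : ℕ) < ℓ then if x i = true then D.reach ℓ x hi else D.reach ℓ x lo else u := by
  rw [reach]
  split <;> simp_all

theorem evalAt_reach (ℓ : ℕ) (x : BVec I) (u : Fin D.numNodes) :
    D.evalAt x (D.reach ℓ x u) = D.evalAt x u := by
  induction u using D.node_induction with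
  | terminal u c h => rw [D.reach_terminal h]
  | decision u i hi lo h ih_hi ih_lo =>
    rw [D.reach_decision h]
    split_ifs with hpos hx
    · rw [ih_hi, D.evalAt_decision h, if_pos hx]
    · rw [ih_lo, D.evalAt_decision h, if_neg hx]
    · rfl

theorem le_level_reach {ℓ : ℕ} (hℓ : ℓ ≤ I) (x : BVec I) (u : Fin D.numNodes) :
    ℓ ≤ (D.node (D.reach ℓ x u)).level D.pos := by
  induction u using D.node_induction with
  | terminal u c h => rwa [D.reach_terminal h, h]
  | decision u i hi lo h ih_hi ih_lo =>
    rw [D.reach_decision h]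
    split_ifs with hpos hx
    · exact ih_hi
    · exact ih_lo
    · rw [h]
      exact not_lt.1 hpos

/-- The constant of a terminal node, with the junk value `0` at a decision node. -/
def terminalValue (u : Fin D.numNodes) : ℝ :=
  match D.node u with
  | .terminal c => c
  | .decision _ _ _ => 0

theorem evalAt_eq_terminalValue (x : BVec I) (u : Fin D.numNodes) :
    D.evalAt x u = D.terminalValue (D.reach I x u) := by
  rw [← D.evalAt_reach I]
  have le_level := D.le_level_reach le_rfl x u
  cases h : D.node (D.reach I x u) with
  | terminal c => rw [D.evalAt_terminal h, terminalValue, h]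
  | decision i hi lo =>
    rw [h] at le_level
    exact absurd (D.pos i).isLt (not_lt.2 le_level)

end ADD

section Gates

variable {V : Type*} {I m : ℕ}

/-- The constraint `w = β` for a binary variable `w`. -/
def constConstraint (w : V) (β : Bool) : Constraint V :=
  if β then ⟨[(-1, w)], -1⟩ else ⟨[(1, w)], 0⟩

theorem constConstraint_holds_iff {w : V} {β : Bool} {b : V → Bool} :
    (constConstraint w β).Holds (boolVal b) ↔ b w = β := by
  cases hw : b w <;> cases β <;> simp [constConstraint, Constraint.Holds, boolVal, hw]

/-- The constraints `w = if x then hi else lo` for binary variables. -/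
def muxConstraints (w x hi lo : V) : List (Constraint V) :=
  [⟨[(1, w), (-1, hi), (1, x)], 1⟩, ⟨[(-1, w), (1, hi), (1, x)], 1⟩,
    ⟨[(1, w), (-1, lo), (-1, x)], 0⟩, ⟨[(-1, w), (1, lo), (-1, x)], 0⟩]

theorem satisfies_muxConstraints {w x hi lo : V} {b : V → Bool} :
    Satisfies (muxConstraints w x hi lo) (boolVal b) ↔
      b w = if b x = true then b hi else b lo := by
  simp only [muxConstraints, Constraint.Holds, Satisfies, List.forall_mem_cons, boolVal,
    List.map_cons, List.map_nil, List.sum_cons, List.sum_nil]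
  cases b w <;> cases b x <;> cases b hi <;> cases b lo <;> norm_num

/-- The value that a node passes on: `c` at a terminal, and the value under `g` of the successor
selected by `x` at a decision node. -/
def ADDNode.select {α : Type*} (x : BVec I) (c : α) (g : Fin m → α) : ADDNode I m → α
  | .terminal _ => c
  | .decision i hi lo => if x i = true then g hi else g lo

/-- The constraints by which a node passes on a bit, `feature u` being the bit at the node `u`. -/
def nodeConstraints (feature : Fin m → V) (input : Fin I → V) (u : Fin m) (β : Bool) :
    ADDNode I m → List (Constraint V)
  | .terminal _ => [constConstraint (feature u) β]
  | .decision i hi lo => muxConstraints (feature u) (input i) (feature hi) (feature lo)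

theorem satisfies_nodeConstraints {feature : Fin m → V} {input : Fin I → V} {u : Fin m} {β : Bool}
    {n : ADDNode I m} {b : V → Bool} :
    Satisfies (nodeConstraints feature input u β n) (boolVal b) ↔
      b (feature u) = n.select (b ∘ input) β (b ∘ feature) := by
  cases n with
  | terminal c => simp [nodeConstraints, ADDNode.select, constConstraint_holds_iff]
  | decision i hi lo => exact satisfies_muxConstraints

theorem totalCost_nodeConstraints_le (feature : Fin m → V) (input : Fin I → V) (u : Fin m)
    (β : Bool) (n : ADDNode I m) : totalCost (nodeConstraints feature input u β n) ≤ 20 := by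
  cases n with
  | terminal c => cases β <;> simp [nodeConstraints, constConstraint, Constraint.cost]
  | decision i hi lo => simp [nodeConstraints, muxConstraints, Constraint.cost]

end Gates

namespace ADD

variable {I : ℕ} (D : ADD I)

variable {D} in
theorem eq_comp_reach_iff {α : Type*} {x : BVec I} {g label : Fin D.numNodes → α} :
    g = label ∘ D.reach I x ↔ ∀ u, g u = (D.node u).select x (label u) g := by
  constructor
  · rintro rfl u
    cases h : D.node u with
    | terminal c => simp [ADDNode.select, D.reach_terminal h]
    | decision i hi lo =>
      simp [ADDNode.select, D.reach_decision h, apply_ite label]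
  · intro hg
    funext u
    induction u using D.node_induction with
    | terminal u c h => simp [hg u, h, ADDNode.select, D.reach_terminal h]
    | decision u i hi lo h ih_hi ih_lo =>
      simp [hg u, h, ADDNode.select, D.reach_decision h, ih_hi, ih_lo, apply_ite label]

/-- The system whose features are, for every node, the bits of the code of the terminal reached
from it. -/
def reachSystem {B : ℕ} (code : Fin D.numNodes → Fin B → Bool) :
    List (Constraint (Var (Fin D.numNodes × Fin B) Empty I)) :=
  gather fun q : Fin D.numNodes × Fin B =>
    nodeConstraints (fun u => .feature (u, q.2)) Var.input q.1 (code q.1 q.2) (D.node q.1)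

theorem isFeatureSystem_reachSystem {B : ℕ} (code : Fin D.numNodes → Fin B → Bool) :
    IsFeatureSystem (D.reachSystem code) fun x q => code (D.reach I x q.1) q.2 := by
  refine isFeatureSystem_iff_of_isEmpty.2 fun x φ' => ?_
  simp only [reachSystem, satisfies_gather, satisfies_nodeConstraints, Prod.forall]
  rw [forall_comm]
  refine Iff.trans ?_ (forall_congr' fun b => eq_comp_reach_iff
    (g := fun u => φ' (u, b)) (label := fun u => code u b))
  simp only [funext_iff, Prod.forall, Function.comp_apply, eq_comm]
  exact forall_comm

theorem totalCost_reachSystem_le {B : ℕ} (code : Fin D.numNodes → Fin B → Bool) :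
    totalCost (D.reachSystem code) ≤ D.numNodes * B * 20 :=
  (totalCost_gather_le fun _ => totalCost_nodeConstraints_le ..).trans (by simp)

variable {D} in
theorem Represents.exists_featureRep {f : BVec I → ℝ} (hf : D.Represents f) :
    ∃ R : MILPFeatureRep I, R.Represents f ∧ R.size ≤ 23 * D.size ^ 2 := by
  have : Nonempty (Fin D.numNodes) := ⟨D.root⟩
  obtain ⟨B, hB, hB', code, code_injective⟩ :=
    exists_injective_code _ (Fintype.card_fin D.numNodes).le
  have hsys := D.isFeatureSystem_reachSystem code
  let ρ (φ' : Fin D.numNodes × Fin B → Bool) : ℝ :=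
    Function.extend code D.terminalValue 0 fun b => φ' (D.root, b)
  have hρ : DependsOn ρ ({D.root} ×ˢ Finset.univ : Finset (Fin D.numNodes × Fin B)) :=
    fun φ' φ'' h => by simp only [ρ, funext fun b => h (D.root, b) (by simp)]
  refine ⟨hsys.toMILPFeatureRep _ ρ hρ, fun x => ?_, (hsys.size_toMILPFeatureRep_le hρ).trans ?_⟩
  · rw [hsys.represents_toMILPFeatureRep hρ x, ← hf x, eval, D.evalAt_eq_terminalValue]
    exact code_injective.extend_apply _ _ (D.reach I x D.root)
  · have hcost := D.totalCost_reachSystem_le code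
    have card_pos : 0 < D.numNodes := Fin.pos_iff_nonempty.2 this
    simp only [Fintype.card_prod, Fintype.card_fin, Fintype.card_empty, Finset.card_product,
      Finset.card_singleton, Finset.card_univ, one_mul, size]
    nlinarith [Nat.mul_le_mul_left D.numNodes hB]

end ADD

/-! ### Parity -/

theorem partialSum_last {M : Type*} [AddCommMonoid M] {n : ℕ} (f : Fin n → M) :
    Fin.partialSum f (Fin.last n) = ∑ i, f i := by
  simp [Fin.partialSum, List.take_of_length_le, List.sum_ofFn]

section Xor

variable {V : Type*}

/-- The constraints `w = u xor x` for binary variables. -/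
def xorConstraints (w u x : V) : List (Constraint V) :=
  [⟨[(1, w), (-1, u), (-1, x)], 0⟩, ⟨[(-1, w), (1, u), (-1, x)], 0⟩,
    ⟨[(-1, w), (-1, u), (1, x)], 0⟩, ⟨[(1, w), (1, u), (1, x)], 2⟩]

theorem satisfies_xorConstraints {w u x : V} {b : V → Bool} :
    Satisfies (xorConstraints w u x) (boolVal b) ↔ b w = (b u ^^ b x) := by
  simp only [xorConstraints, Satisfies, Constraint.Holds, List.forall_mem_cons, boolVal,
    List.map_cons, List.map_nil, List.sum_cons, List.sum_nil]
  cases b w <;> cases b u <;> cases b x <;> norm_num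

end Xor

/-- Whether the number of ones among the first `k` components of `x` is odd. -/
def oddPrefix {I : ℕ} (x : BVec I) (k : Fin (I + 1)) : Bool :=
  decide (Odd (Fin.partialSum (fun i => (x i).toNat) k))

theorem oddPrefix_zero {I : ℕ} (x : BVec I) : oddPrefix x 0 = false := by
  simp [oddPrefix]

theorem oddPrefix_succ {I : ℕ} (x : BVec I) (i : Fin I) :
    oddPrefix x i.succ = (oddPrefix x i.castSucc ^^ x i) := by
  cases hx : x i <;>
    simp [oddPrefix, Fin.partialSum_succ, hx, Nat.odd_add_one, -Nat.not_odd_iff_even]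

theorem parity_eq_ite_oddPrefix {I : ℕ} (x : BVec I) :
    parity I x = if oddPrefix x (Fin.last I) = true then 0 else 1 := by
  by_cases h : Even (∑ i, (x i).toNat) <;> simp [parity, oddPrefix, partialSum_last, h]

/-- The system computing the parities of all the prefixes of the input one after the other. -/
def paritySystem (I : ℕ) : List (Constraint (Var (Fin (I + 1)) Empty I)) :=
  constConstraint (.feature 0) false ::
    gather fun i : Fin I => xorConstraints (.feature i.succ) (.feature i.castSucc) (.input i)

theorem isFeatureSystem_paritySystem (I : ℕ) : IsFeatureSystem (paritySystem I) oddPrefix := by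
  refine isFeatureSystem_iff_of_isEmpty.2 fun x φ' => ?_
  simp only [paritySystem, satisfies_cons, satisfies_gather, constConstraint_holds_iff,
    satisfies_xorConstraints, Sum.elim_inl, Sum.elim_inr]
  constructor
  · rintro rfl
    exact ⟨oddPrefix_zero x, oddPrefix_succ x⟩
  · rintro ⟨zero, succ⟩
    funext k
    induction k using Fin.induction with
    | zero => rw [zero, oddPrefix_zero]
    | succ i ih => rw [oddPrefix_succ, ih, succ]

theorem totalCost_paritySystem (I : ℕ) : totalCost (paritySystem I) = 18 * I + 2 := by
  simp [paritySystem, constConstraint, xorConstraints, Constraint.cost]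
  ring

theorem exists_featureRep_parity {I : ℕ} (hI : 1 ≤ I) :
    ∃ R : MILPFeatureRep I, R.Represents (parity I) ∧ R.size ≤ 24 * I := by
  have hsys := isFeatureSystem_paritySystem I
  let ρ (φ : BVec (I + 1)) : ℝ := if φ (Fin.last I) = true then 0 else 1
  have hρ : DependsOn ρ ({Fin.last I} : Finset (Fin (I + 1))) :=
    fun φ φ' h => by simp only [ρ, h (Fin.last I) (by simp)]
  refine ⟨hsys.toMILPFeatureRep _ ρ hρ, fun x => ?_, (hsys.size_toMILPFeatureRep_le hρ).trans ?_⟩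
  · rw [hsys.represents_toMILPFeatureRep hρ x, parity_eq_ite_oddPrefix]
  · rw [totalCost_paritySystem, Fintype.card_fin, Fintype.card_empty, Finset.card_singleton]
    lia

/-! ### Binary multiplication -/

theorem binVal_eq_ofBits {n : ℕ} (a : BVec n) : binVal a = Nat.ofBits a := by
  induction n with
  | zero => simp [binVal]
  | succ n ih =>
    rw [Nat.ofBits_succ, ← ih (a ∘ Fin.succ), binVal, binVal, Fin.sum_univ_succ, Finset.mul_sum,
      add_comm]
    congr 1
    · refine Finset.sum_congr rfl fun i _ => ?_
      rw [Function.comp_apply, Fin.val_succ, pow_succ]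
      ring
    · simp

theorem binVal_lt {n : ℕ} (a : BVec n) : binVal a < 2 ^ n :=
  binVal_eq_ofBits a ▸ Nat.ofBits_lt_two_pow a

theorem testBit_eq_iff_binVal_eq {n N : ℕ} (hN : N < 2 ^ n) {a : BVec n} :
    (fun k : Fin n => N.testBit k) = a ↔ binVal a = N := by
  rw [binVal_eq_ofBits]
  constructor
  · rintro rfl
    rw [Nat.ofBits_testBit, Nat.mod_eq_of_lt hN]
  · rintro rfl
    funext k
    exact Nat.testBit_ofBits_lt a k k.isLt

theorem cast_binVal {n : ℕ} (a : BVec n) :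
    (binVal a : ℝ) = ∑ i : Fin n, boolVal a i * 2 ^ (i : ℕ) := by
  simp [binVal, boolVal]

section Arithmetic

variable {V : Type*} {n : ℕ}

/-- The equation `∑ a v = 0` as two inequalities. -/
def zeroConstraints (terms : List (ℤ × V)) : List (Constraint V) :=
  [⟨terms, 0⟩, ⟨terms.map fun t => (-t.1, t.2), 0⟩]

theorem satisfies_zeroConstraints {terms : List (ℤ × V)} {v : V → ℝ} :
    Satisfies (zeroConstraints terms) v ↔ (terms.map fun t => (t.1 : ℝ) * v t.2).sum = 0 := by
  have sum_neg : (terms.map fun t => -((t.1 : ℝ) * v t.2)).sum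
      = -(terms.map fun t => (t.1 : ℝ) * v t.2).sum := by
    rw [List.sum_neg, List.map_map]
    rfl
  simp [zeroConstraints, Constraint.Holds, Function.comp_def, sum_neg, le_antisymm_iff]

/-- The constraints `z = a * y` for a binary variable `a` and a variable `y` in `[0, 1]`. -/
def productConstraints (z a y : V) : List (Constraint V) :=
  [⟨[(1, z), (-1, a)], 0⟩, ⟨[(1, z), (-1, y)], 0⟩, ⟨[(-1, z)], 0⟩, ⟨[(1, a), (1, y), (-1, z)], 1⟩]

theorem satisfies_productConstraints {z a y : V} {v : V → ℝ} (ha : v a = 0 ∨ v a = 1)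
    (hy : v y ∈ Set.Icc 0 1) : Satisfies (productConstraints z a y) v ↔ v z = v a * v y := by
  obtain ⟨y_nonneg, y_le_one⟩ := hy
  simp only [productConstraints, satisfies_cons, satisfies_nil, Constraint.Holds, List.map_cons,
    List.map_nil, List.sum_cons, List.sum_nil]
  push_cast
  rcases ha with ha | ha <;> rw [ha]
  · constructor
    · rintro ⟨z_le_a, -, z_nonneg, -⟩
      linarith
    · intro h
      refine ⟨?_, ?_, ?_, ?_, trivial⟩ <;> linarith
  · constructor
    · rintro ⟨-, z_le_y, -, y_le_z, -⟩
      linarith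
    · intro h
      refine ⟨?_, ?_, ?_, ?_, trivial⟩ <;> linarith

/-- The constraints `state 0 = 0` and `2 * state (i + 1) = state i + digit i`, which shift the
digits into the state.  Halving the state instead of doubling the digits keeps all the coefficients
bounded. -/
def shiftConstraints (state : Fin (n + 1) → V) (digit : Fin n → V) : List (Constraint V) :=
  zeroConstraints [(1, state 0)] ++ gather fun i : Fin n =>
    zeroConstraints [(2, state i.succ), (-1, state i.castSucc), (-1, digit i)]

/-- The states `∑_{i < k} d i * 2 ^ i / 2 ^ k` of the shift register that reads the digits `d`. -/
def shiftRegister (d : Fin n → ℝ) (k : Fin (n + 1)) : ℝ :=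
  Fin.partialSum (fun i => d i * 2 ^ (i : ℕ)) k / 2 ^ (k : ℕ)

theorem shiftRegister_zero (d : Fin n → ℝ) : shiftRegister d 0 = 0 := by
  simp [shiftRegister]

theorem two_mul_shiftRegister_succ (d : Fin n → ℝ) (i : Fin n) :
    2 * shiftRegister d i.succ = shiftRegister d i.castSucc + d i := by
  rw [shiftRegister, shiftRegister, Fin.partialSum_succ, Fin.val_succ, Fin.val_castSucc, pow_succ]
  field_simp

theorem satisfies_shiftConstraints {state : Fin (n + 1) → V} {digit : Fin n → V} {v : V → ℝ} :
    Satisfies (shiftConstraints state digit) v ↔ v ∘ state = shiftRegister (v ∘ digit) := by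
  have recursion_iff : Satisfies (shiftConstraints state digit) v ↔
      v (state 0) = 0 ∧ ∀ i, 2 * v (state i.succ) = v (state i.castSucc) + v (digit i) := by
    simp only [shiftConstraints, satisfies_append, satisfies_gather, satisfies_zeroConstraints,
      List.map_cons, List.map_nil, List.sum_cons, List.sum_nil]
    push_cast
    refine and_congr (by simp) (forall_congr' fun i => ?_)
    constructor <;> intro h <;> linarith
  rw [recursion_iff]
  constructor
  · rintro ⟨zero, succ⟩
    funext k
    induction k using Fin.induction with
    | zero => rw [Function.comp_apply, zero, shiftRegister_zero]
    | succ i ih =>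
      have := two_mul_shiftRegister_succ (v ∘ digit) i
      rw [← ih] at this
      simp only [Function.comp_apply] at this ⊢
      linarith [succ i]
  · intro h
    simp only [funext_iff, Function.comp_apply] at h
    simp only [h, shiftRegister_zero, two_mul_shiftRegister_succ, Function.comp_apply, true_and,
      implies_true]

theorem shiftRegister_last (d : Fin n → ℝ) :
    shiftRegister d (Fin.last n) = (∑ i, d i * 2 ^ (i : ℕ)) / 2 ^ n := by
  rw [shiftRegister, partialSum_last, Fin.val_last]

theorem totalCost_shiftConstraints (state : Fin (n + 1) → V) (digit : Fin n → V) :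
    totalCost (shiftConstraints state digit) = 10 * n + 4 := by
  simp [shiftConstraints, zeroConstraints, Constraint.cost]
  ring

end Arithmetic

/-- The auxiliary variables of the multiplication system: the shift register reading the second
factor, the products of its last state with the bits of the first factor, the shift register reading
these products, and the one reading the bits of the product. -/
abbrev MulVar (I : ℕ) : Type :=
  (Fin (I + 1) ⊕ Fin I) ⊕ (Fin (I + 1) ⊕ Fin (2 * I + 1))

theorem card_mulVar (I : ℕ) : Fintype.card (MulVar I) = 5 * I + 3 := by
  simp only [Fintype.card_sum, Fintype.card_fin]
  ring

section Multiplication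

variable {I : ℕ}

namespace MulVar

/-- The states of the shift register reading the second factor. -/
abbrev factor (k : Fin (I + 1)) : MulVar I := .inl (.inl k)

/-- The products of the second factor, scaled to `[0, 1]`, with the bits of the first one. -/
abbrev partialProduct (k : Fin I) : MulVar I := .inl (.inr k)

/-- The states of the shift register reading the partial products. -/
abbrev accumulator (k : Fin (I + 1)) : MulVar I := .inr (.inl k)

/-- The states of the shift register reading the bits of the product. -/
abbrev result (k : Fin (2 * I + 1)) : MulVar I := .inr (.inr k)

end MulVar

/-- The first factor of the input `(a, b)`. -/
def leftFactor (x : BVec (I + I)) : BVec I := fun i => x (Fin.castAdd I i)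

/-- The second factor of the input `(a, b)`. -/
def rightFactor (x : BVec (I + I)) : BVec I := fun i => x (Fin.natAdd I i)

/-- The bits of the product of the two factors. -/
def productBits (x : BVec (I + I)) (k : Fin (2 * I)) : Bool :=
  (binVal (leftFactor x) * binVal (rightFactor x)).testBit k

theorem mulBit_eq_ite_productBits (k : Fin (2 * I)) (x : BVec (I + I)) :
    mulBit I k x = if productBits x k = true then 1 else 0 := rfl

theorem productBits_eq_iff {x : BVec (I + I)} {φ : BVec (2 * I)} :
    productBits x = φ ↔ binVal φ = binVal (leftFactor x) * binVal (rightFactor x) := by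
  refine testBit_eq_iff_binVal_eq ?_
  rw [two_mul, pow_add]
  exact Nat.mul_lt_mul'' (binVal_lt _) (binVal_lt _)

open MulVar in
/-- The system computing the bits of the product by adding up the partial products. -/
def mulSystem (I : ℕ) : List (Constraint (Var (Fin (2 * I)) (MulVar I) (I + I))) :=
  shiftConstraints (fun k => .aux (factor k)) (fun i => .input (Fin.natAdd I i)) ++
    (gather fun i : Fin I => productConstraints (.aux (partialProduct i))
      (.input (Fin.castAdd I i)) (.aux (factor (Fin.last I)))) ++
    shiftConstraints (fun k => .aux (accumulator k)) (fun i => .aux (partialProduct i)) ++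
    shiftConstraints (fun k => .aux (result k)) (fun j => .feature j) ++
    zeroConstraints [(1, .aux (result (Fin.last (2 * I)))), (-1, .aux (accumulator (Fin.last I)))]

theorem totalCost_mulSystem (I : ℕ) : totalCost (mulSystem I) = 53 * I + 18 := by
  simp [mulSystem, totalCost_shiftConstraints, productConstraints, zeroConstraints,
    Constraint.cost]
  ring

theorem shiftRegister_boolVal_last {n : ℕ} (a : BVec n) :
    shiftRegister (boolVal a) (Fin.last n) = binVal a / 2 ^ n := by
  rw [shiftRegister_last, cast_binVal]

theorem shiftRegister_boolVal_mul_last {n : ℕ} (a : BVec n) (y : ℝ) :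
    shiftRegister (fun i => boolVal a i * y) (Fin.last n) = binVal a * y / 2 ^ n := by
  rw [shiftRegister_last, cast_binVal, Finset.sum_mul]
  simp only [mul_right_comm]

theorem binVal_div_two_pow_mem_Icc {n : ℕ} (a : BVec n) :
    (binVal a / 2 ^ n : ℝ) ∈ Set.Icc 0 1 := by
  refine ⟨by positivity, (div_le_one (by positivity)).2 ?_⟩
  exact_mod_cast (binVal_lt a).le

open MulVar in
theorem satisfies_partialProducts_iff {x : BVec (I + I)} {φ : BVec (2 * I)} {ζ : MulVar I → ℝ}
    (hfactor : ζ ∘ factor = shiftRegister (boolVal (rightFactor x))) :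
    (∀ i : Fin I, Satisfies (productConstraints (.aux (partialProduct i))
        (.input (Fin.castAdd I i)) (.aux (factor (Fin.last I)))) (assign φ ζ x)) ↔
      ζ ∘ partialProduct =
        fun i => boolVal (leftFactor x) i * (binVal (rightFactor x) / 2 ^ I) := by
  have factor_last : ζ (factor (Fin.last I)) = binVal (rightFactor x) / 2 ^ I :=
    (congrFun hfactor _).trans (shiftRegister_boolVal_last _)
  rw [funext_iff]
  refine forall_congr' fun i => ?_
  rw [satisfies_productConstraints]
  · simp only [assign, Sum.elim_inr, Sum.elim_inl, factor_last]
    rfl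
  · cases h : x (Fin.castAdd I i) <;> simp [assign, boolVal, h]
  · simpa [assign, factor_last] using binVal_div_two_pow_mem_Icc (rightFactor x)

open MulVar in
theorem satisfies_mulSystem_iff {x : BVec (I + I)} {φ : BVec (2 * I)} {ζ : MulVar I → ℝ} :
    Satisfies (mulSystem I) (assign φ ζ x) ↔
      ζ ∘ factor = shiftRegister (boolVal (rightFactor x)) ∧
      (ζ ∘ partialProduct = fun i =>
        boolVal (leftFactor x) i * (binVal (rightFactor x) / 2 ^ I)) ∧
      ζ ∘ accumulator = shiftRegister (ζ ∘ partialProduct) ∧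
      ζ ∘ result = shiftRegister (boolVal φ) ∧
      binVal φ = binVal (leftFactor x) * binVal (rightFactor x) := by
  simp only [mulSystem, satisfies_append, satisfies_shiftConstraints, satisfies_gather, and_assoc]
  refine and_congr_right fun hfactor => ?_
  rw [satisfies_partialProducts_iff (φ := φ) hfactor]
  refine and_congr_right fun hproduct => and_congr_right fun hacc => and_congr_right fun hres => ?_
  have acc_last : ζ (accumulator (Fin.last I))
      = binVal (leftFactor x) * (binVal (rightFactor x) / 2 ^ I) / 2 ^ I := by
    rw [← shiftRegister_boolVal_mul_last, ← hproduct]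
    exact congrFun hacc _
  have res_last : ζ (result (Fin.last (2 * I))) = binVal φ / (2 ^ I * 2 ^ I) := by
    rw [← pow_add, ← two_mul, ← shiftRegister_boolVal_last]
    exact congrFun hres _
  simp only [satisfies_zeroConstraints, List.map_cons, List.map_nil, List.sum_cons, List.sum_nil,
    assign, Sum.elim_inr, Sum.elim_inl, acc_last, res_last]
  rw [← Nat.cast_inj (R := ℝ)]
  push_cast
  field_simp
  simp [add_neg_eq_zero]

theorem isFeatureSystem_mulSystem (I : ℕ) : IsFeatureSystem (mulSystem I) productBits := by
  intro x φ
  simp only [productBits_eq_iff, satisfies_mulSystem_iff]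
  constructor
  · intro h
    let products (i : Fin I) : ℝ := boolVal (leftFactor x) i * (binVal (rightFactor x) / 2 ^ I)
    exact ⟨Sum.elim (Sum.elim (shiftRegister (boolVal (rightFactor x))) products)
      (Sum.elim (shiftRegister products) (shiftRegister (boolVal φ))), rfl, rfl, rfl, rfl, h⟩
  · rintro ⟨ζ, -, -, -, -, h⟩
    exact h

theorem exists_featureRep_mulBit {k : ℕ} (hI : 1 ≤ I) (hk : k < 2 * I) :
    ∃ R : MILPFeatureRep (I + I), R.Represents (mulBit I k) ∧ R.size ≤ 83 * I := by
  have hsys := isFeatureSystem_mulSystem I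
  let ρ (φ : BVec (2 * I)) : ℝ := if φ ⟨k, hk⟩ = true then 1 else 0
  have hρ : DependsOn ρ ({⟨k, hk⟩} : Finset (Fin (2 * I))) :=
    fun φ φ' h => by simp only [ρ, h ⟨k, hk⟩ (by simp)]
  refine ⟨hsys.toMILPFeatureRep _ ρ hρ, fun x => ?_, (hsys.size_toMILPFeatureRep_le hρ).trans ?_⟩
  · exact (hsys.represents_toMILPFeatureRep hρ x).trans (mulBit_eq_ite_productBits ⟨k, hk⟩ x).symm
  · rw [totalCost_mulSystem, card_mulVar, Fintype.card_fin, Finset.card_singleton]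
    lia

end Multiplication

/-- The middle bit of the product and the parity of the input in one function, which is therefore
hard for all the three classical representations. -/
def mulParity (I : ℕ) (x : BVec (I + I)) : ℝ := mulBit I (I - 1) x + 2 * parity (I + I) x

theorem exists_featureRep_mulParity {I : ℕ} (hI : 1 ≤ I) :
    ∃ R : MILPFeatureRep (I + I), R.Represents (mulParity I) ∧ I ≤ R.size ∧
      R.size ≤ 126 * I := by
  have hsys := (isFeatureSystem_mulSystem I).join (isFeatureSystem_paritySystem (I + I))
  let middle : Fin (2 * I) := ⟨I - 1, by lia⟩
  let ρ (φ : Fin (2 * I) ⊕ Fin (I + I + 1) → Bool) : ℝ :=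
    (if φ (.inl middle) = true then 1 else 0)
      + 2 * if φ (.inr (Fin.last (I + I))) = true then 0 else 1
  have hρ : DependsOn ρ
      ({.inl middle, .inr (Fin.last (I + I))} : Finset (Fin (2 * I) ⊕ Fin (I + I + 1))) :=
    fun φ φ' h => by simp only [ρ, h (.inl middle) (by simp), h (.inr (Fin.last _)) (by simp)]
  refine ⟨hsys.toMILPFeatureRep _ ρ hρ, fun x => ?_,
    le_trans ?_ (hsys.card_le_size_toMILPFeatureRep hρ),
    (hsys.size_toMILPFeatureRep_le hρ).trans ?_⟩
  · rw [hsys.represents_toMILPFeatureRep hρ x, mulParity, parity_eq_ite_oddPrefix,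
      mulBit_eq_ite_productBits middle]
    rfl
  · simp only [Fintype.card_sum, Fintype.card_fin]
    lia
  · rw [totalCost_joinSystems, totalCost_mulSystem, totalCost_paritySystem,
      Finset.card_pair (by simp), Fintype.card_sum, Fintype.card_sum, card_mulVar, Fintype.card_fin,
      Fintype.card_fin, Fintype.card_empty]
    lia

/-! ### Lower bounds for decision trees and rule systems -/

section Rules

variable {I : ℕ}

/-- Every change of a single component changes the value of `f`. -/
def FlipSensitive {α : Type*} (f : BVec I → α) : Prop :=
  ∀ x i, f (Function.update x i (!x i)) ≠ f x

theorem FlipSensitive.of_factorsThrough {α β : Type*} {f : BVec I → α} {g : BVec I → β}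
    (hg : FlipSensitive g) (hgf : g.FactorsThrough f) : FlipSensitive f :=
  fun x i h => hg x i (hgf h)

theorem flipSensitive_parity (I : ℕ) : FlipSensitive (parity I) := by
  intro x i
  have sum_update : ∑ j ∈ {i}ᶜ, (Function.update x i (!x i) j).toNat = ∑ j ∈ {i}ᶜ, (x j).toNat :=
    Finset.sum_congr rfl fun j hj => by rw [Function.update_of_ne (by simpa using hj)]
  simp only [parity, Fintype.sum_eq_add_sum_compl i, sum_update, Function.update_self]
  cases x i <;> by_cases rest_even : Even (∑ j ∈ {i}ᶜ, (x j).toNat) <;>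
    simp [rest_even, Nat.even_add, Nat.not_even_one]

theorem RuleSystem.injective_rule_of_flipSensitive {S : RuleSystem I} {f : BVec I → ℝ}
    (hS : S.Represents f) (hf : FlipSensitive f) : Function.Injective S.rule := by
  intro x y hxy
  by_contra hne
  obtain ⟨i, hi⟩ := Function.ne_iff.1 hne
  refine hf x i ?_
  rw [hS _ x (S.rule_spec x)]
  refine hS _ _ fun p hp => ?_
  have hx := S.rule_spec x p hp
  have hy := S.rule_spec y p (hxy ▸ hp)
  have hpi : p.1 ≠ i := by
    rintro rfl
    exact hi (hx.trans hy.symm)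
  rw [Function.update_of_ne hpi, hx]

theorem RuleSystem.two_pow_le_numRules {S : RuleSystem I} {f : BVec I → ℝ} (hS : S.Represents f)
    (hf : FlipSensitive f) : 2 ^ I ≤ S.numRules := by
  simpa using Fintype.card_le_of_injective S.rule (injective_rule_of_flipSensitive hS hf)

theorem RuleSystem.two_pow_le_size {S : RuleSystem I} {f : BVec I → ℝ} (hS : S.Represents f)
    (hf : FlipSensitive f) : 2 ^ I ≤ S.size :=
  (two_pow_le_numRules hS hf).trans S.numRules_le_size

theorem DecisionTree.two_pow_le_size {T : DecisionTree I} {f : BVec I → ℝ} (hT : T.Represents f)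
    (hf : FlipSensitive f) : 2 ^ I ≤ T.size := by
  have hrules : T.toRuleSystem.Represents f := fun r x h =>
    (hT x).symm.trans (T.represents_toRuleSystem r x h)
  exact (RuleSystem.two_pow_le_numRules hrules hf).trans T.numRules_toRuleSystem_le

end Rules

/-! ### Lower bounds for algebraic decision diagrams -/

namespace ADD

variable {I : ℕ} (D : ADD I)

theorem reach_congr {ℓ : ℕ} {x y : BVec I} (h : ∀ i, (D.pos i : ℕ) < ℓ → x i = y i)
    (u : Fin D.numNodes) : D.reach ℓ x u = D.reach ℓ y u := by
  induction u using D.node_induction with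
  | terminal u c hu => rw [D.reach_terminal hu, D.reach_terminal hu]
  | decision u i hi lo hu ih_hi ih_lo =>
    rw [D.reach_decision hu, D.reach_decision hu, ih_hi, ih_lo]
    split_ifs with hpos hx hy hy
    all_goals simp_all

theorem evalAt_congr {ℓ : ℕ} {x y : BVec I} (h : ∀ i, ℓ ≤ (D.pos i : ℕ) → x i = y i)
    {u : Fin D.numNodes} (hu : ℓ ≤ (D.node u).level D.pos) : D.evalAt x u = D.evalAt y u := by
  induction u using D.node_induction with
  | terminal u c hc => rw [D.evalAt_terminal hc, D.evalAt_terminal hc]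
  | decision u i hi lo hd ih_hi ih_lo =>
    obtain ⟨lt_hi, lt_lo⟩ := D.ordered u i hi lo hd
    rw [hd] at hu
    rw [D.evalAt_decision hd, D.evalAt_decision hd, h i hu, ih_hi (hu.trans lt_hi.le),
      ih_lo (hu.trans lt_lo.le)]

/-- The input that agrees with `x` on the first `ℓ` variables in the order of the diagram, and with
`y` on the others. -/
def splice (ℓ : ℕ) (x y : BVec I) : BVec I := fun i => if (D.pos i : ℕ) < ℓ then x i else y i

theorem eval_splice {ℓ : ℕ} (hℓ : ℓ ≤ I) (x y : BVec I) :
    D.eval (D.splice ℓ x y) = D.evalAt y (D.reach ℓ x D.root) := by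
  have reach_eq : D.reach ℓ (D.splice ℓ x y) D.root = D.reach ℓ x D.root :=
    D.reach_congr (fun i hi => if_pos hi) _
  rw [eval, ← D.evalAt_reach ℓ, reach_eq]
  exact D.evalAt_congr (fun i hi => if_neg hi.not_gt) (D.le_level_reach hℓ x D.root)

variable {D} in
theorem Represents.card_le_size_of_fooling {f : BVec I → ℝ} (hD : D.Represents f) {ℓ : ℕ}
    (hℓ : ℓ ≤ I) {ι : Type*} [Fintype ι] {x : ι → BVec I}
    (hx : Pairwise fun s t => ∃ y, f (D.splice ℓ (x s) y) ≠ f (D.splice ℓ (x t) y)) :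
    Fintype.card ι ≤ D.size := by
  have reach_injective : Function.Injective fun s => D.reach ℓ (x s) D.root := by
    intro s t hst
    by_contra hne
    obtain ⟨y, hy⟩ := hx hne
    rw [← hD, ← hD, D.eval_splice hℓ, D.eval_splice hℓ] at hy
    exact hy (congrArg (D.evalAt y) hst)
  simpa [size] using Fintype.card_le_of_injective _ reach_injective

variable {D} in
theorem Represents.two_le_size {f : BVec I → ℝ} (hD : D.Represents f) {x y : BVec I}
    (hxy : f x ≠ f y) : 2 ≤ D.size := by
  have splice_eq (x y : BVec I) : D.splice I x y = x := funext fun i => if_pos (D.pos i).isLt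
  have fooling : Pairwise fun s t : Bool => ∃ z,
      f (D.splice I (cond s x y) z) ≠ f (D.splice I (cond t x y) z) := by
    simp only [splice_eq, exists_const]
    rintro (_ | _) (_ | _) hst
    exacts [absurd rfl hst, hxy.symm, hxy, absurd rfl hst]
  simpa using hD.card_le_size_of_fooling le_rfl fooling

end ADD

/-! ### The middle bit of multiplication -/

/-- The `n`-bit number whose ones are at the positions in `s`. -/
def digits (n : ℕ) (s : Finset ℕ) : BVec n := fun i => decide (↑i ∈ s)

theorem binVal_digits {n : ℕ} {s : Finset ℕ} (hs : s ⊆ Finset.range n) :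
    binVal (digits n s) = ∑ k ∈ s, 2 ^ k := by
  calc binVal (digits n s) = ∑ k ∈ Finset.range n, (decide (k ∈ s)).toNat * 2 ^ k :=
        (Finset.sum_range fun k => (decide (k ∈ s)).toNat * 2 ^ k).symm
    _ = ∑ k ∈ Finset.range n, if k ∈ s then 2 ^ k else 0 := by
      refine Finset.sum_congr rfl fun k _ => ?_
      by_cases hk : k ∈ s <;> simp [hk]
    _ = ∑ k ∈ s, 2 ^ k := by rw [Finset.sum_ite_mem, Finset.inter_eq_right.2 hs]

section TwoWindows

variable {e d : ℕ} {A B : Finset ℕ}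

/-- The positions `e + a` and `e + d + b` with `a ∈ A` and `b ∈ B`. -/
def twoWindows (e d : ℕ) (A B : Finset ℕ) : Finset ℕ :=
  A.map (addLeftEmbedding e) ∪ B.map (addLeftEmbedding (e + d))

theorem mem_twoWindows {m : ℕ} :
    m ∈ twoWindows e d A B ↔ (∃ a ∈ A, e + a = m) ∨ ∃ b ∈ B, e + d + b = m := by
  simp [twoWindows]

theorem twoWindows_subset_range {w n : ℕ} (hA : A ⊆ Finset.range w) (hB : B ⊆ Finset.range w)
    (hn : e + d + w ≤ n) : twoWindows e d A B ⊆ Finset.range n := by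
  intro m hm
  rw [Finset.mem_range]
  obtain ⟨a, ha, rfl⟩ | ⟨b, hb, rfl⟩ := mem_twoWindows.1 hm
  · have := Finset.mem_range.1 (hA ha)
    lia
  · have := Finset.mem_range.1 (hB hb)
    lia

theorem sum_two_pow_twoWindows (hA : A ⊆ Finset.range d) :
    ∑ m ∈ twoWindows e d A B, 2 ^ m = 2 ^ e * (∑ k ∈ A, 2 ^ k + 2 ^ d * ∑ k ∈ B, 2 ^ k) := by
  have windows_disjoint :
      Disjoint (A.map (addLeftEmbedding e)) (B.map (addLeftEmbedding (e + d))) := by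
    simp only [Finset.disjoint_left, Finset.mem_map, addLeftEmbedding_apply]
    rintro _ ⟨a, ha, rfl⟩ ⟨b, -, hab⟩
    have := Finset.mem_range.1 (hA ha)
    lia
  rw [twoWindows, Finset.sum_union windows_disjoint]
  simp only [Finset.sum_map, addLeftEmbedding_apply, pow_add, ← Finset.mul_sum]
  ring

theorem testBit_shifted_product {e p d w a b : ℕ} (hw : w < d) (ha : a < 2 ^ w) (hb : b < 2 ^ w) :
    (2 ^ e * (a + 2 ^ d * b) * (2 ^ p * (1 + 2 ^ d))).testBit (e + p + d + w)
      = decide (2 ^ w ≤ a + b) := by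
  have two_pow_le : 2 ^ (w + 1) ≤ 2 ^ d := Nat.pow_le_pow_right two_pos hw
  rw [pow_succ] at two_pow_le
  have product_eq : 2 ^ e * (a + 2 ^ d * b) * (2 ^ p * (1 + 2 ^ d))
      = 2 ^ (e + p) * (2 ^ d * (2 ^ d * b + (a + b)) + a) := by
    simp only [pow_add]
    ring
  rw [product_eq, show e + p + d + w = e + p + (d + w) by ring, Nat.testBit_two_pow_mul,
    Nat.add_sub_cancel_left, decide_eq_true (Nat.le_add_right _ _), Bool.true_and,
    Nat.testBit_two_pow_mul_add _ (by lia), if_neg (by lia), Nat.add_sub_cancel_left,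
    Nat.testBit_two_pow_mul_add _ (by lia), if_pos hw]
  by_cases carry : 2 ^ w ≤ a + b
  · rw [decide_eq_true carry]
    exact Nat.testBit_of_two_pow_le_and_two_pow_add_one_gt carry (by rw [pow_succ]; lia)
  · rw [decide_eq_false carry]
    exact Nat.testBit_lt_two_pow (not_le.1 carry)

theorem testBit_mul_twoWindows {w : ℕ} (p : ℕ) (hw : w < d) (hA : A ⊆ Finset.range w)
    (hB : B ⊆ Finset.range w) :
    ((∑ m ∈ twoWindows e d A B, 2 ^ m) * ∑ m ∈ twoWindows p d {0} {0}, 2 ^ m).testBit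
      (e + p + d + w) = decide (2 ^ w ≤ ∑ k ∈ A, 2 ^ k + ∑ k ∈ B, 2 ^ k) := by
  have sum_lt {s : Finset ℕ} (hs : s ⊆ Finset.range w) : ∑ k ∈ s, 2 ^ k < 2 ^ w :=
    Nat.geomSum_lt le_rfl fun k hk => Finset.mem_range.1 (hs hk)
  rw [sum_two_pow_twoWindows (hA.trans (Finset.range_mono hw.le)),
    sum_two_pow_twoWindows (by simpa using hw.pos), Finset.sum_singleton, pow_zero, mul_one]
  exact testBit_shifted_product hw (sum_lt hA) (sum_lt hB)

end TwoWindows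

section Fooling

variable (top : ℕ → Prop) [DecidablePred top] (e d w : ℕ) (s s₀ : Finset ℕ)

/-- The offsets at which exactly one of the windows starting at `e` and at `e + d` satisfies
`top`. -/
def splitOffsets : Finset ℕ := {k ∈ Finset.range w | ¬(top (e + k) ↔ top (e + d + k))}

/-- The offsets of the ones in the lower window of `foolingPositions`. -/
def foolingLow : Finset ℕ := {k ∈ splitOffsets top e d w | if top (e + k) then k ∈ s else k ∉ s₀}

/-- The offsets of the ones in the upper window of `foolingPositions`. -/
def foolingHigh : Finset ℕ :=
  {k ∈ Finset.range w | k ∈ splitOffsets top e d w → if top (e + d + k) then k ∈ s else k ∉ s₀}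

/-- The positions of the ones of a number that carries, in two windows of length `w` at distance
`d`, the set `s` at the split positions satisfying `top` and the complement of `s₀` at the other
split positions.  At the offsets that are not split, the lower digit is `0` and the upper one is
`1`, so that they pass on a carry. -/
def foolingPositions : Finset ℕ :=
  twoWindows e d (foolingLow top e d w s s₀) (foolingHigh top e d w s s₀)

theorem foolingLow_subset_range : foolingLow top e d w s s₀ ⊆ Finset.range w :=
  (Finset.filter_subset _ _).trans (Finset.filter_subset _ _)

theorem foolingHigh_subset_range : foolingHigh top e d w s s₀ ⊆ Finset.range w :=
  Finset.filter_subset _ _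

variable {top e d w s s₀}

theorem mem_foolingPositions_iff {m : ℕ} :
    m ∈ foolingPositions top e d w s s₀ ↔ if top m then m ∈ foolingPositions top e d w s s
      else m ∈ foolingPositions top e d w s₀ s₀ := by
  simp only [foolingPositions, mem_twoWindows, foolingLow, foolingHigh, Finset.mem_filter]
  split_ifs with hm
  all_goals
    refine or_congr (exists_congr fun k => and_congr_left ?_)
      (exists_congr fun k => and_congr_left ?_)
    all_goals
      rintro rfl
      simp only [hm, if_true, if_false]

theorem sum_foolingLow_add_sum_foolingHigh (hs : s ⊆ splitOffsets top e d w)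
    (hs₀ : s₀ ⊆ splitOffsets top e d w) :
    ∑ k ∈ foolingLow top e d w s s₀, 2 ^ k + ∑ k ∈ foolingHigh top e d w s s₀, 2 ^ k
      + ∑ k ∈ s₀, 2 ^ k = ∑ k ∈ Finset.range w, 2 ^ k + ∑ k ∈ s, 2 ^ k := by
  have sum_eq {r : Finset ℕ} (hr : r ⊆ Finset.range w) :
      ∑ k ∈ r, 2 ^ k = ∑ k ∈ Finset.range w, if k ∈ r then 2 ^ k else 0 := by
    rw [Finset.sum_ite_mem, Finset.inter_eq_right.2 hr]
  have splitOffsets_subset : splitOffsets top e d w ⊆ Finset.range w := Finset.filter_subset _ _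
  rw [sum_eq (foolingLow_subset_range ..), sum_eq (foolingHigh_subset_range ..),
    sum_eq (hs.trans splitOffsets_subset), sum_eq (hs₀.trans splitOffsets_subset)]
  simp only [← Finset.sum_add_distrib]
  refine Finset.sum_congr rfl fun k hk => ?_
  have mem_of_mem_s : k ∈ s → k ∈ splitOffsets top e d w := @hs k
  have mem_of_mem_s₀ : k ∈ s₀ → k ∈ splitOffsets top e d w := @hs₀ k
  have mem_splitOffsets : k ∈ splitOffsets top e d w ↔ ¬(top (e + k) ↔ top (e + d + k)) := by
    simp [splitOffsets, Finset.mem_range.1 hk]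
  simp only [foolingLow, foolingHigh, Finset.mem_filter, hk, true_and]
  by_cases htop : top (e + k) <;> by_cases htop' : top (e + d + k) <;>
    by_cases k ∈ s <;> by_cases k ∈ s₀ <;> simp_all

theorem testBit_mul_foolingPositions (p : ℕ) (hw : w < d) (hs : s ⊆ splitOffsets top e d w)
    (hs₀ : s₀ ⊆ splitOffsets top e d w) :
    ((∑ m ∈ foolingPositions top e d w s s₀, 2 ^ m)
      * ∑ m ∈ twoWindows p d {0} {0}, 2 ^ m).testBit (e + p + d + w)
      = decide (∑ k ∈ s₀, 2 ^ k < ∑ k ∈ s, 2 ^ k) := by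
  have sum_eq := sum_foolingLow_add_sum_foolingHigh hs hs₀
  have geom_sum : ∑ k ∈ Finset.range w, 2 ^ k + 1 = 2 ^ w := by
    rw [Nat.geomSum_eq le_rfl, Nat.div_one, Nat.sub_add_cancel Nat.one_le_two_pow]
  rw [foolingPositions, testBit_mul_twoWindows p hw (foolingLow_subset_range ..)
    (foolingHigh_subset_range ..), decide_eq_decide]
  lia

/-- The two factors whose product compares `s` with other sets of offsets: the second factor adds up
the two windows of the first one. -/
def foolingInput (n : ℕ) (top : ℕ → Prop) [DecidablePred top] (e d w : ℕ) (s : Finset ℕ) :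
    BVec (n + n) :=
  Fin.append (digits n (foolingPositions top e d w s s))
    (digits n (twoWindows (n - 1 - (e + d + w)) d {0} {0}))

theorem mulBit_append_digits {n k : ℕ} {A B : Finset ℕ} (hA : A ⊆ Finset.range n)
    (hB : B ⊆ Finset.range n) : mulBit n k (Fin.append (digits n A) (digits n B))
      = if ((∑ m ∈ A, 2 ^ m) * ∑ m ∈ B, 2 ^ m).testBit k = true then 1 else 0 := by
  simp only [mulBit, Fin.append_left, Fin.append_right, binVal_digits hA, binVal_digits hB]

end Fooling

section Splitting

theorem exists_card_filter_lt_eq {α : Type*} {S : Finset α} {P : α → ℕ} (hP : Set.InjOn P S)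
    {g : ℕ} (hg : g < #S) : ∃ a ∈ S, #{b ∈ S | P b < P a} = g := by
  classical
  have finite_image : {m | m ∈ S.image P}.Finite := (S.image P).finite_toSet
  have card_image : #finite_image.toFinset = #S := by
    rw [Finset.finite_toSet_toFinset, Finset.card_image_of_injOn hP]
  have nth_mem := Nat.nth_mem_of_lt_card finite_image (card_image ▸ hg)
  have count_eq := Nat.count_nth_of_lt_card_finite finite_image (card_image ▸ hg)
  obtain ⟨a, ha, hPa⟩ := Finset.mem_image.1 nth_mem
  refine ⟨a, ha, ?_⟩
  have injOn_filter := hP.mono (Finset.coe_subset.2 (Finset.filter_subset (P · < P a) S))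
  rw [← Finset.card_image_of_injOn injOn_filter, ← count_eq, Nat.count_eq_card_filter_range, ← hPa]
  congr 1
  ext m
  simp only [Finset.mem_image, Finset.mem_filter, Finset.mem_range]
  grind

theorem two_mul_card_filter_not_iff {α : Type*} {S : Finset α} {P : α → Prop} [DecidablePred P]
    (hP : 2 * #{a ∈ S | P a} = #S) (c : Prop) [Decidable c] :
    2 * #{a ∈ S | ¬(P a ↔ c)} = #S := by
  have card_add_card_not := Finset.card_filter_add_card_filter_not (s := S) P
  by_cases hc : c
  · simp only [hc, iff_true]
    lia
  · simpa only [hc, iff_false, not_not] using hP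

variable {top : ℕ → Prop} [DecidablePred top] {q : ℕ}

theorem card_splitPairs (htop : #{m ∈ Finset.range (4 * q) | top m} = 2 * q) :
    #{p ∈ Finset.range (4 * q) ×ˢ Finset.Ioc (4 * q) (8 * q) | ¬(top p.1 ↔ top p.2)}
      = 8 * q * q := by
  have half (j : ℕ) : #{i ∈ Finset.range (4 * q) | ¬(top i ↔ top j)} = 2 * q := by
    have := two_mul_card_filter_not_iff (S := Finset.range (4 * q)) (P := top)
      (by rw [htop, Finset.card_range]; ring) (top j)
    rw [Finset.card_range] at this
    lia
  simp only [Finset.card_filter, Finset.sum_product_right]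
  simp only [← Finset.card_filter, half, Finset.sum_const, Nat.card_Ioc, smul_eq_mul]
  rw [show 8 * q - 4 * q = 4 * q by lia]
  ring

theorem exists_le_card_splitOffsets (hq : 0 < q)
    (htop : #{m ∈ Finset.range (4 * q) | top m} = 2 * q) :
    ∃ e d w, w < d ∧ e + d + w ≤ 8 * q + 1 ∧ q ≤ #(splitOffsets top e d w) := by
  obtain ⟨d, hd, hfiber⟩ := Finset.exists_le_card_fiber_of_mul_le_card_of_maps_to
    (s := {p ∈ Finset.range (4 * q) ×ˢ Finset.Ioc (4 * q) (8 * q) | ¬(top p.1 ↔ top p.2)})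
    (t := Finset.Icc 1 (8 * q)) (f := fun p => p.2 - p.1) (n := q)
    (fun p hp => by
      simp only [Finset.mem_filter, Finset.mem_product, Finset.mem_range, Finset.mem_Ioc] at hp
      rw [Finset.mem_Icc]
      lia)
    ⟨1, by rw [Finset.mem_Icc]; lia⟩ (by rw [card_splitPairs htop, Nat.card_Icc]; lia)
  rw [Finset.mem_Icc] at hd
  let e := 4 * q + 1 - d
  refine ⟨e, d, min (4 * q) (8 * q + 1 - d) - e, by lia, by lia, hfiber.trans ?_⟩
  refine Finset.card_le_card_of_injOn (fun p => p.1 - e) ?_ ?_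
  · rintro ⟨i, j⟩ hp
    simp only [splitOffsets, Finset.coe_filter, Finset.mem_filter, Finset.mem_product,
      Finset.mem_range, Finset.mem_Ioc, Set.mem_ofPred_eq] at hp ⊢
    obtain ⟨⟨⟨hi, hj⟩, hsplit⟩, hij⟩ := hp
    refine ⟨by lia, ?_⟩
    rwa [show e + (i - e) = i by lia, show e + d + (i - e) = j by lia]
  · rintro ⟨i, j⟩ hp ⟨i', j'⟩ hp' heq
    simp only [Finset.coe_filter, Finset.mem_filter, Finset.mem_product, Finset.mem_range,
      Finset.mem_Ioc, Set.mem_ofPred_eq] at hp hp' heq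
    ext <;> simp only <;> lia

end Splitting

section MiddleBit

variable {n : ℕ}

namespace ADD

variable (D : ADD (n + n))

/-- The position in the variable order of the digit of weight `2 ^ m` of the first factor. -/
def digitPos : Equiv.Perm ℕ := D.pos.viaEmbedding Fin.valEmbedding

theorem digitPos_val (i : Fin n) : D.digitPos i = (D.pos (Fin.castAdd n i) : ℕ) :=
  D.pos.viaEmbedding_apply Fin.valEmbedding (Fin.castAdd n i)

theorem splice_foolingInput {ℓ e d w : ℕ} {s s₀ : Finset ℕ} :
    D.splice ℓ (foolingInput n (D.digitPos · < ℓ) e d w s)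
      (foolingInput n (D.digitPos · < ℓ) e d w s₀)
      = Fin.append (digits n (foolingPositions (D.digitPos · < ℓ) e d w s s₀))
        (digits n (twoWindows (n - 1 - (e + d + w)) d {0} {0})) := by
  funext i
  refine Fin.addCases (fun i => ?_) (fun i => ?_) i
  · simp only [splice, foolingInput, Fin.append_left, digits, ← D.digitPos_val,
      mem_foolingPositions_iff (s := s) (s₀ := s₀)]
    split_ifs <;> rfl
  · simp only [splice, foolingInput, Fin.append_right, ite_self]

theorem mulBit_splice_foolingInput {ℓ e d w : ℕ} (hw : w < d) (hn : e + d + w < n)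
    {s s₀ : Finset ℕ} (hs : s ⊆ splitOffsets (D.digitPos · < ℓ) e d w)
    (hs₀ : s₀ ⊆ splitOffsets (D.digitPos · < ℓ) e d w) :
    mulBit n (n - 1) (D.splice ℓ (foolingInput n (D.digitPos · < ℓ) e d w s)
      (foolingInput n (D.digitPos · < ℓ) e d w s₀))
      = if ∑ k ∈ s₀, 2 ^ k < ∑ k ∈ s, 2 ^ k then 1 else 0 := by
  have middle_eq : n - 1 = e + (n - 1 - (e + d + w)) + d + w := by lia
  have testBit_eq := testBit_mul_foolingPositions (n - 1 - (e + d + w)) hw hs hs₀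
  rw [← middle_eq] at testBit_eq
  rw [splice_foolingInput, mulBit_append_digits, testBit_eq]
  · simp only [decide_eq_true_eq]
  · exact twoWindows_subset_range (foolingLow_subset_range ..) (foolingHigh_subset_range ..) hn.le
  · exact twoWindows_subset_range (w := 1) (by simp) (by simp) (by lia)

variable {D} {f : BVec (n + n) → ℝ}

theorem Represents.two_pow_card_splitOffsets_le_size (hD : D.Represents f)
    (hf : (mulBit n (n - 1)).FactorsThrough f) {ℓ e d w : ℕ} (hℓ : ℓ ≤ n + n) (hw : w < d)
    (hn : e + d + w < n) : 2 ^ #(splitOffsets (D.digitPos · < ℓ) e d w) ≤ D.size := by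
  let x (s : (splitOffsets (D.digitPos · < ℓ) e d w).powerset) :=
    foolingInput n (D.digitPos · < ℓ) e d w s
  have mulBit_splice (s t : (splitOffsets (D.digitPos · < ℓ) e d w).powerset) :=
    D.mulBit_splice_foolingInput hw hn (Finset.mem_powerset.1 s.2) (Finset.mem_powerset.1 t.2)
  have fooling : Pairwise fun s t => ∃ y, f (D.splice ℓ (x s) y) ≠ f (D.splice ℓ (x t) y) := by
    intro s t hst
    have sum_ne : ∑ k ∈ s.1, 2 ^ k ≠ ∑ k ∈ t.1, 2 ^ k := fun h =>
      hst (Subtype.ext (Finset.geomSum_injective le_rfl h))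
    obtain hlt | hlt := sum_ne.lt_or_gt
    · refine ⟨x s, fun h => zero_ne_one (α := ℝ) ?_⟩
      simpa [x, mulBit_splice, hlt] using hf h
    · refine ⟨x t, fun h => one_ne_zero (α := ℝ) ?_⟩
      simpa [x, mulBit_splice, hlt] using hf h
  simpa using hD.card_le_size_of_fooling hℓ fooling

theorem Represents.two_pow_le_size_of_mulBit (hD : D.Represents f)
    (hf : (mulBit n (n - 1)).FactorsThrough f) {q : ℕ} (hq : 0 < q) (hn : 8 * q + 2 ≤ n) :
    2 ^ q ≤ D.size := by
  obtain ⟨a, ha, half_lt⟩ := exists_card_filter_lt_eq (S := Finset.range (4 * q))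
    D.digitPos.injective.injOn (g := 2 * q) (by rw [Finset.card_range]; lia)
  obtain ⟨e, d, w, hw, hedw, hcard⟩ := exists_le_card_splitOffsets hq half_lt
  have digitPos_le : D.digitPos a ≤ n + n := by
    rw [Finset.mem_range] at ha
    exact (D.digitPos_val ⟨a, by lia⟩).trans_le (Fin.isLt _).le
  calc 2 ^ q ≤ 2 ^ #(splitOffsets (D.digitPos · < D.digitPos a) e d w) :=
        Nat.pow_le_pow_right two_pos hcard
    _ ≤ D.size := hD.two_pow_card_splitOffsets_le_size hf digitPos_le hw (by lia)

end ADD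

theorem exists_mulBit_ne (hn : 0 < n) : ∃ x y, mulBit n (n - 1) x ≠ mulBit n (n - 1) y := by
  refine ⟨Fin.append (digits n {n - 1}) (digits n {0}), Fin.append (digits n ∅) (digits n ∅), ?_⟩
  rw [mulBit_append_digits (by simpa using hn) (by simpa using hn),
    mulBit_append_digits (by simp) (by simp)]
  simp [Nat.testBit_two_pow_self]

theorem ADD.Represents.exists_two_pow_le_size_of_mulBit {D : ADD (n + n)} {f : BVec (n + n) → ℝ}
    (hD : D.Represents f) (hf : (mulBit n (n - 1)).FactorsThrough f) (hn : 0 < n) :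
    ∃ k, n ≤ 17 * k ∧ 2 ^ k ≤ D.size := by
  by_cases hn' : n ≤ 17
  · obtain ⟨x, y, hxy⟩ := exists_mulBit_ne hn
    exact ⟨1, hn', hD.two_le_size fun h => hxy (hf h)⟩
  · exact ⟨(n - 2) / 8, by lia, hD.two_pow_le_size_of_mulBit hf (by lia) (by lia)⟩

end MiddleBit

/-! ### The exponential gap -/

section Gap

variable {I : ℕ}

theorem mulBit_eq_zero_or_one (k : ℕ) (x : BVec (I + I)) : mulBit I k x = 0 ∨ mulBit I k x = 1 :=
  (ite_eq_or_eq _ _ _).symm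

theorem parity_eq_zero_or_one (x : BVec I) : parity I x = 0 ∨ parity I x = 1 :=
  (ite_eq_or_eq _ _ _).symm

theorem mulParity_eq_iff {x y : BVec (I + I)} : mulParity I x = mulParity I y ↔
    mulBit I (I - 1) x = mulBit I (I - 1) y ∧ parity (I + I) x = parity (I + I) y := by
  refine ⟨fun h => ?_, fun ⟨hmul, hparity⟩ => by rw [mulParity, mulParity, hmul, hparity]⟩
  rw [mulParity, mulParity] at h
  obtain hx | hx := mulBit_eq_zero_or_one (I - 1) x <;>
    obtain hy | hy := mulBit_eq_zero_or_one (I - 1) y <;>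
    obtain px | px := parity_eq_zero_or_one x <;>
    obtain py | py := parity_eq_zero_or_one y <;>
    grind

theorem flipSensitive_mulParity (I : ℕ) : FlipSensitive (mulParity I) :=
  (flipSensitive_parity (I + I)).of_factorsThrough fun _ _ h => (mulParity_eq_iff.1 h).2

theorem mulBit_factorsThrough_mulParity (I : ℕ) :
    (mulBit I (I - 1)).FactorsThrough (mulParity I) :=
  fun _ _ h => (mulParity_eq_iff.1 h).1

theorem two_rpow_le_of_two_pow_le {x : ℝ} {k m : ℕ} (hx : x ≤ k) (hm : 2 ^ k ≤ m) :
    (2 : ℝ) ^ x ≤ m :=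
  calc (2 : ℝ) ^ x ≤ (2 : ℝ) ^ (k : ℝ) := Real.rpow_le_rpow_of_exponent_le one_le_two hx
    _ = ((2 ^ k : ℕ) : ℝ) := by rw [Real.rpow_natCast, Nat.cast_pow, Nat.cast_ofNat]
    _ ≤ m := Nat.cast_le.2 hm

theorem ADD.Represents.two_rpow_le_size_of_mulBit {D : ADD (I + I)} {f : BVec (I + I) → ℝ}
    (hD : D.Represents f) (hf : (mulBit I (I - 1)).FactorsThrough f) (hI : 0 < I) :
    (2 : ℝ) ^ (1 / 17 * (I : ℝ)) ≤ D.size := by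
  obtain ⟨k, hk, hsize⟩ := hD.exists_two_pow_le_size_of_mulBit hf hI
  refine two_rpow_le_of_two_pow_le ?_ hsize
  have : (I : ℝ) ≤ 17 * k := by exact_mod_cast hk
  linarith

theorem exists_exponential_gap : ∃ δ : ℝ, 0 < δ ∧ ∀ N : ℕ,
    ∃ (I : ℕ) (f : BVec I → ℝ) (R : MILPFeatureRep I), R.Represents f ∧ N ≤ R.size ∧
      (∀ T : DecisionTree I, T.Represents f → (2 : ℝ) ^ (δ * R.size) ≤ T.size) ∧
      (∀ D : ADD I, D.Represents f → (2 : ℝ) ^ (δ * R.size) ≤ D.size) ∧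
      (∀ S : RuleSystem I, S.Represents f → (2 : ℝ) ^ (δ * R.size) ≤ S.size) := by
  refine ⟨1 / (17 * 126), by norm_num, fun N => ?_⟩
  obtain ⟨R, hR, le_size, size_le⟩ := exists_featureRep_mulParity N.succ_pos
  have size_le' : (R.size : ℝ) ≤ 126 * (N.succ : ℝ) := by exact_mod_cast size_le
  have exponent_le : 1 / (17 * 126) * (R.size : ℝ) ≤ 1 / 17 * (N.succ : ℝ) := by linarith
  have exponent_le' : 1 / (17 * 126) * (R.size : ℝ) ≤ (N.succ + N.succ : ℕ) := by
    rw [Nat.cast_add]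
    linarith [Nat.cast_nonneg (α := ℝ) N.succ]
  have hflip := flipSensitive_mulParity N.succ
  refine ⟨_, mulParity N.succ, R, hR, N.le_succ.trans le_size, fun T hT => ?_, fun D hD => ?_,
    fun S hS => ?_⟩
  · exact two_rpow_le_of_two_pow_le exponent_le' (DecisionTree.two_pow_le_size hT hflip)
  · exact (Real.rpow_le_rpow_of_exponent_le one_le_two exponent_le).trans
      (hD.two_rpow_le_size_of_mulBit (mulBit_factorsThrough_mulParity _) N.succ_pos)
  · exact two_rpow_le_of_two_pow_le exponent_le' (RuleSystem.two_pow_le_size hS hflip)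

end Gap

end CSI

end

theorem mainTheorem7 :
    -- (i) polynomial-size simulation by MILP-based feature representations
    (∃ p : Polynomial ℕ, ∀ (I : ℕ) (f : CSI.BVec I → ℝ),
      (∀ T : CSI.DecisionTree I, T.Represents f →
        ∃ R : CSI.MILPFeatureRep I, R.Represents f ∧ R.size ≤ p.eval T.size) ∧
      (∀ D : CSI.ADD I, D.Represents f →
        ∃ R : CSI.MILPFeatureRep I, R.Represents f ∧ R.size ≤ p.eval D.size) ∧
      (∀ S : CSI.RuleSystem I, S.Represents f →
        ∃ R : CSI.MILPFeatureRep I, R.Represents f ∧ R.size ≤ p.eval S.size)) ∧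
    -- (ii) arbitrarily large MILP-based feature representations for which every equivalent
    -- tree, ADD and rule system is exponentially larger
    (∃ δ : ℝ, 0 < δ ∧ ∀ N : ℕ, ∃ (I : ℕ) (f : CSI.BVec I → ℝ) (R : CSI.MILPFeatureRep I),
      R.Represents f ∧ N ≤ R.size ∧
      (∀ T : CSI.DecisionTree I, T.Represents f → (2 : ℝ) ^ (δ * R.size) ≤ T.size) ∧
      (∀ D : CSI.ADD I, D.Represents f → (2 : ℝ) ^ (δ * R.size) ≤ D.size) ∧
      (∀ S : CSI.RuleSystem I, S.Represents f → (2 : ℝ) ^ (δ * R.size) ≤ S.size)) ∧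
    -- (ii), parity against trees and rule systems
    (∃ C : ℕ, ∀ I : ℕ, 1 ≤ I →
      (∃ R : CSI.MILPFeatureRep I, R.Represents (CSI.parity I) ∧ R.size ≤ C * I) ∧
      (∀ T : CSI.DecisionTree I, T.Represents (CSI.parity I) → 2 ^ I ≤ T.size) ∧
      (∀ S : CSI.RuleSystem I, S.Represents (CSI.parity I) → 2 ^ I ≤ S.size)) ∧
    -- (ii), the bits of binary multiplication (the middle one against ADDs)
    (∃ (C : ℕ) (δ : ℝ), 0 < δ ∧ ∀ I : ℕ, 1 ≤ I →
      (∀ k < 2 * I, ∃ R : CSI.MILPFeatureRep (I + I),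
        R.Represents (CSI.mulBit I k) ∧ R.size ≤ C * I) ∧
      (∀ D : CSI.ADD (I + I), D.Represents (CSI.mulBit I (I - 1)) →
        (2 : ℝ) ^ (δ * I) ≤ D.size)) := by
  refine ⟨⟨8 * Polynomial.X ^ 3 + 23 * Polynomial.X ^ 2, fun I f => ?_⟩,
    CSI.exists_exponential_gap,
    ⟨24, fun I hI => ⟨CSI.exists_featureRep_parity hI,
      fun T hT => CSI.DecisionTree.two_pow_le_size hT (CSI.flipSensitive_parity I),
      fun S hS => CSI.RuleSystem.two_pow_le_size hS (CSI.flipSensitive_parity I)⟩⟩,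
    ⟨83, 1 / 17, by norm_num, fun I hI => ⟨fun k hk => CSI.exists_featureRep_mulBit hI hk,
      fun D hD => hD.two_rpow_le_size_of_mulBit (fun _ _ h => h) hI⟩⟩⟩
  simp only [Polynomial.eval_add, Polynomial.eval_mul, Polynomial.eval_ofNat, Polynomial.eval_pow,
    Polynomial.eval_X]
  refine ⟨fun T hT => ?_, fun D hD => ?_, fun S hS => ?_⟩
  · obtain ⟨R, hR, size_le⟩ := hT.exists_featureRep
    exact ⟨R, hR, size_le.trans (Nat.le_add_right _ _)⟩
  · obtain ⟨R, hR, size_le⟩ := hD.exists_featureRep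
    exact ⟨R, hR, size_le.trans (Nat.le_add_left _ _)⟩
  · obtain ⟨R, hR, size_le⟩ := hS.exists_featureRep S.numRules_le_size S.card_antecedents_le_size
    exact ⟨R, hR, size_le.trans (Nat.le_add_right _ _)⟩
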